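/- **Theorem.** Every convenient diffeological vector space is elastic. *Conventions.* Let $\mathbf{Cart}$ be the category of open subsets of the spaces $\mathbb R^n$ ($n\ge 0$) and smooth maps, viewed inside the category of diffeological spaces. Let $V$ be a diffeological vector space over $\mathbb R$ (addition $V\times V\to V$ and scalar multiplication $\mathbb R\times V\to V$ are smooth), and let $L^\infty(V)$ be the set of smooth linear maps $V\to\mathbb R$. Then $V$ is *convenient* if * its plots are exactly the maps $p\colon U\to V$, $U\in\mathbf{Cart}$, such that $l\circ p$ is smooth for all $l\in L^\infty(V)$; * $L^\infty(V)$ separates the points of $V$; * every smooth curve $c\colon\mathbb R\to V$ is infinitely weakly differentiable: there are curves $c=c_0,c_1,c_2,\dots\colon\mathbb R\to V$ such that, for all $k\ge 0$ and $l\in L^\infty(V)$, $l\circ c_k$ is differentiable with derivative $l\circ c_{k+1}$. For a functor $\hat F$ from $\mathbf{Cart}$ to diffeological spaces, $\mathbb L\hat F$ is its left Kan extension along the inclusion of $\mathbf{Cart}$: $(\mathbb L\hat F)X=\operatorname{colim}_{(U,p)}\hat F U$ over the category of plots $p\colon U\to X$, with the colimit diffeology; $p_*x\in(\mathbb L\hat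 F)X$ is the class of $x\in \hat FU$ in the component of the plot $p$. A natural transformation $\hat\alpha\colon\hat F\to\hat G$ induces $\mathbb L\hat\alpha\colon p_*x\mapsto p_*\hat\alpha_U(x)$. Let $\hat T U=U\times\mathbb R^n$, $\hat Tf(u,v)=(f(u),D_uf(v))$, with projection $\hat\pi(u,v)=u$; let $\hat T_k$ be the $k$-fold fibre power of $\hat T$ over $\hat\pi$, $\hat T^2=\hat T\circ\hat T$, $\hat\tau(u,v_0,v_1,v_{01})=(u,v_1,v_0,v_{01})$ on $\hat T^2$, and $\hat\lambda(u,v)=(u,0,0,v)$ from $\hat T$ to $\hat T^2$. Put $T=\mathbb L\hat T$, with footprint $\pi\colon TX\to X$, $p_*(u,v)\mapsto p(u)$, and let $T_kX$ be the $k$-fold fibre power of $TX$ over $X$ ($T_0X=X$). There are natural maps $$\theta_k\colon(\mathbb L\hat T_k)X\to T_kX,\quad p_*(u,v_0,\dots,v_{k-1})\mapsto(p_*(u,v_0),\dots,p_*(u,v_{k-1})),$$ $$\theta^2\colon(\mathbb L\hat T^2)X\to T^2X,\quad p_*x\mapsto (Tp)_*x,$$ $$\nu_k\colon T(T_kX)\to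 T^2X\times_{TX}\cdots\times_{TX}T^2X,\quad z\mapsto (T\mathrm{pr}_1(z),\dots,T\mathrm{pr}_k(z)),$$ where $Tp\colon\hat TU\to TX$ is the plot $x\mapsto p_*x$ and the fibre product in the last line is over $T\pi$. A diffeological space $X$ is *elastic* if * (E1) $\theta_k$ is an isomorphism of diffeological spaces for all $k\ge1$; * (E2) there is a smooth map $\tau\colon T^2X\to T^2X$ with $\tau\circ\theta^2=\theta^2\circ(\mathbb L\hat\tau)_X$; * (E3) the vertical lift $\lambda_X=\theta^2\circ(\mathbb L\hat\lambda)_X\colon TX\to T^2X$ is an induction, i.e. it is injective and $TX$ carries the pullback diffeology along it; * (E4) $\nu_k$ is injective for all $k\ge1$; * (E5) for all natural numbers $k_1,\dots,k_n$ ($n \ge 0$), the space $T_{k_1}\cdots T_{k_n}X$ satisfies (E1)–(E4). -/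

import Mathlib

open scoped ContDiff

noncomputable section

namespace ElasticDflg

open Diffeology

universe u v w

/-! ## Generalities on diffeological spaces -/

/-- The pullback (initial) diffeology along a map `f`: a map `p` is a plot iff `f ∘ p` is. -/
abbrev inducedDiffeology {X : Type u} {Y : Type v} [DiffeologicalSpace Y] (f : X → Y) :
    DiffeologicalSpace X where
  plots n := {p | IsPlot (f ∘ p)}
  constant_plots x := isPlot_const (x := f x)
  plot_reparam hp hf := isPlot_reparam (X := Y) hp hf
  locality {n p} hp := DiffeologicalSpace.locality (X := Y) fun x => by
    obtain ⟨s, hs, hx, h⟩ := hp x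
    exact ⟨s, hs, hx, fun {m f} h1 h2 => h h1 h2⟩

/-- Subsets carry the subspace diffeology. -/
instance {X : Type u} [DiffeologicalSpace X] {P : X → Prop} : DiffeologicalSpace (Subtype P) :=
  inducedDiffeology Subtype.val

/-- The product diffeology on a binary product. -/
instance {X : Type u} {Y : Type v} [DiffeologicalSpace X] [DiffeologicalSpace Y] :
    DiffeologicalSpace (X × Y) where
  plots n := {p | IsPlot (fun t => (p t).1) ∧ IsPlot (fun t => (p t).2)}
  constant_plots x := ⟨isPlot_const, isPlot_const⟩
  plot_reparam hp hf := ⟨isPlot_reparam hp.1 hf, isPlot_reparam hp.2 hf⟩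
  locality {n p} hp := by
    constructor
    · refine DiffeologicalSpace.locality (X := X) fun x => ?_
      obtain ⟨s, hs, hx, h⟩ := hp x
      exact ⟨s, hs, hx, fun {m f} h1 h2 => (h h1 h2).1⟩
    · refine DiffeologicalSpace.locality (X := Y) fun x => ?_
      obtain ⟨s, hs, hx, h⟩ := hp x
      exact ⟨s, hs, hx, fun {m f} h1 h2 => (h h1 h2).2⟩

/-- The product diffeology on an indexed product. -/
instance {ι : Type v} {X : ι → Type u} [∀ i, DiffeologicalSpace (X i)] :
    DiffeologicalSpace (∀ i, X i) where
  plots n := {p | ∀ i, IsPlot (fun t => p t i)}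
  constant_plots x := fun _ => isPlot_const
  plot_reparam hp hf := fun i => isPlot_reparam (hp i) hf
  locality {n p} hp := fun i => by
    refine DiffeologicalSpace.locality (X := X i) fun x => ?_
    obtain ⟨s, hs, hx, h⟩ := hp x
    exact ⟨s, hs, hx, fun {m f} h1 h2 => h h1 h2 i⟩

/-- Smooth maps between diffeological spaces: the morphisms of the category of diffeological
spaces. -/
structure SMap (X : Type u) (Y : Type v) [DiffeologicalSpace X] [DiffeologicalSpace Y] where
  toFun : X → Y
  smooth : DSmooth toFun

instance {X : Type u} {Y : Type v} [DiffeologicalSpace X] [DiffeologicalSpace Y] :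
    FunLike (SMap X Y) X Y where
  coe := SMap.toFun
  coe_injective f g h := by
    cases f; cases g; congr

theorem SMap.ext {X : Type u} {Y : Type v} [DiffeologicalSpace X] [DiffeologicalSpace Y]
    {f g : SMap X Y} (h : ∀ x, f x = g x) : f = g := DFunLike.ext f g h

/-- The identity. -/
def SMap.id (X : Type u) [DiffeologicalSpace X] : SMap X X := ⟨fun x => x, dSmooth_id⟩

/-- Composition `g ∘ f`. -/
def SMap.comp {X : Type u} {Y : Type v} {Z : Type w} [DiffeologicalSpace X]
    [DiffeologicalSpace Y] [DiffeologicalSpace Z] (g : SMap Y Z) (f : SMap X Y) : SMap X Z :=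
  ⟨fun x => g (f x), g.smooth.comp f.smooth⟩

/-- Isomorphisms of diffeological spaces. -/
def IsDiffeomorphism {X : Type u} {Y : Type v} [DiffeologicalSpace X] [DiffeologicalSpace Y]
    (f : X → Y) : Prop :=
  DSmooth f ∧ ∃ g : Y → X, DSmooth g ∧ Function.LeftInverse g f ∧ Function.RightInverse g f

/-- Inductions: injective maps whose source carries the pullback diffeology. -/
def IsInduction {X : Type u} {Y : Type v} [DiffeologicalSpace X] [DiffeologicalSpace Y]
    (f : X → Y) : Prop :=
  Function.Injective f ∧
    ∀ (n : ℕ) (p : EuclideanSpace ℝ (Fin n) → X), IsPlot p ↔ IsPlot (f ∘ p)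

/-- The `k`-fold fibre power `Y ×_X ⋯ ×_X Y` of `f : Y → X`, with the base point recorded
(so that the `0`-fold fibre power is `X`). -/
def FiberPow {X : Type u} {Y : Type v} (f : Y → X) (k : ℕ) : Type (max u v) :=
  {z : X × (Fin k → Y) // ∀ i, f (z.2 i) = z.1}

instance {X : Type u} {Y : Type v} [DiffeologicalSpace X] [DiffeologicalSpace Y] (f : Y → X)
    (k : ℕ) : DiffeologicalSpace (FiberPow f k) :=
  inferInstanceAs (DiffeologicalSpace {z : X × (Fin k → Y) // ∀ i, f (z.2 i) = z.1})

/-- The projection of a fibre power to the base. -/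
def FiberPow.base {X : Type u} {Y : Type v} [DiffeologicalSpace X] [DiffeologicalSpace Y]
    (f : Y → X) (k : ℕ) : SMap (FiberPow f k) X := ⟨fun z => z.1.1, fun _ _ hp => hp.1⟩

/-- The `i`-th projection of a fibre power. -/
def FiberPow.proj {X : Type u} {Y : Type v} [DiffeologicalSpace X] [DiffeologicalSpace Y]
    (f : Y → X) (k : ℕ) (i : Fin k) : SMap (FiberPow f k) Y :=
  ⟨fun z => z.1.2 i, fun _ _ hp => hp.2 i⟩

/-! ## The category of open subsets of Cartesian spaces -/

/-- The objects: open subsets of the spaces `ℝⁿ`. The morphisms from `U` to `U'` are the smooth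
maps `SMap U U'` for the subspace diffeologies (equivalently the smooth maps in the usual sense,
see `Cart.contDiffOn_extend` and `Cart.dSmooth_of_contDiffOn`). -/
structure Cart where
  dim : ℕ
  carrier : Set (EuclideanSpace ℝ (Fin dim))
  isOpen : IsOpen carrier

instance : CoeSort Cart Type := ⟨fun U => U.carrier⟩

open Classical in
/-- Extension by zero of a map on `U`; used only to speak about derivatives at points of `U`. -/
def Cart.extend {U : Cart} {m : ℕ} (f : U → EuclideanSpace ℝ (Fin m)) :
    EuclideanSpace ℝ (Fin U.dim) → EuclideanSpace ℝ (Fin m) :=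
  fun x => if h : x ∈ U.carrier then f ⟨x, h⟩ else 0

theorem Cart.extend_apply {U : Cart} {m : ℕ} (f : U → EuclideanSpace ℝ (Fin m)) (x : U) :
    Cart.extend f x = f x := dif_pos x.2

theorem Cart.contDiffOn_extend {U : Cart} {m : ℕ} {f : U → EuclideanSpace ℝ (Fin m)}
    (hf : DSmooth f) : ContDiffOn ℝ ∞ (Cart.extend f) U.carrier := by
  intro x hx
  obtain ⟨ε, hε, hb⟩ := Metric.isOpen_iff.mp U.isOpen x hx
  have hmem : ∀ y, OpenPartialHomeomorph.univBall x ε y ∈ U.carrier := fun y => hb (by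
    have := (OpenPartialHomeomorph.univBall x ε).map_source (x := y)
    rw [OpenPartialHomeomorph.univBall_target x hε] at this
    exact this (by simp))
  have h1 : ContDiff ℝ ∞ (fun y => f ⟨OpenPartialHomeomorph.univBall x ε y, hmem y⟩) :=
    hf U.dim (fun y => ⟨_, hmem y⟩)
      (OpenPartialHomeomorph.contDiff_univBall (c := x) (r := ε))
  have h2 := h1.comp_contDiffOn
    (OpenPartialHomeomorph.contDiffOn_univBall_symm (c := x) (r := ε))
  have h3 : ContDiffOn ℝ ∞ (Cart.extend f) (Metric.ball x ε) := by
    refine h2.congr fun y hy => ?_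
    have hy' : OpenPartialHomeomorph.univBall x ε
        ((OpenPartialHomeomorph.univBall x ε).symm y) = y :=
      (OpenPartialHomeomorph.univBall x ε).right_inv (by
        rw [OpenPartialHomeomorph.univBall_target x hε]; exact hy)
    rw [Cart.extend, dif_pos (hb hy)]
    simp only [Function.comp, hy']
  exact (h3.contDiffAt (Metric.ball_mem_nhds x hε)).contDiffWithinAt

theorem Cart.dSmooth_of_contDiffOn {U : Cart} {m : ℕ} {f : U → EuclideanSpace ℝ (Fin m)}
    {g : EuclideanSpace ℝ (Fin U.dim) → EuclideanSpace ℝ (Fin m)}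
    (hg : ContDiffOn ℝ ∞ g U.carrier) (h : ∀ x : U, f x = g x) : DSmooth f := by
  intro n p hp
  have hp' : ContDiff ℝ ∞ (fun t => (p t : EuclideanSpace ℝ (Fin U.dim))) := hp
  have h2 := hg.comp_contDiff hp' (fun t => (p t).2)
  have : f ∘ p = g ∘ fun t => (p t : EuclideanSpace ℝ (Fin U.dim)) := funext fun t => h (p t)
  rw [this]
  exact h2

/-- The derivative `D_x f` of a smooth map `f : U → U'` at a point `x` of `U`. -/
def Cart.deriv {U U' : Cart} (f : SMap U U') (x : U) :
    EuclideanSpace ℝ (Fin U.dim) →L[ℝ] EuclideanSpace ℝ (Fin U'.dim) :=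
  fderiv ℝ (Cart.extend fun y => (f y).1) x

theorem Cart.contDiffOn_map {U U' : Cart} (f : SMap U U') :
    ContDiffOn ℝ ∞ (Cart.extend fun y => (f y).1) U.carrier :=
  Cart.contDiffOn_extend fun n p hp => f.smooth n p hp

theorem Cart.hasFDerivAt {U U' : Cart} (f : SMap U U') (x : U) :
    HasFDerivAt (Cart.extend fun y => (f y).1) (Cart.deriv f x) x :=
  (((Cart.contDiffOn_map f).contDiffAt (U.isOpen.mem_nhds x.2)).differentiableAt
    (by simp)).hasFDerivAt

theorem Cart.deriv_id {U : Cart} (x : U) :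
    Cart.deriv (SMap.id U) x = ContinuousLinearMap.id ℝ _ := by
  refine (Cart.hasFDerivAt (SMap.id U) x).unique ((hasFDerivAt_id x.1).congr_of_eventuallyEq ?_)
  filter_upwards [U.isOpen.mem_nhds x.2] with y hy
  exact Cart.extend_apply (U := U) _ ⟨y, hy⟩

theorem Cart.deriv_comp {U U' U'' : Cart} (g : SMap U' U'') (f : SMap U U') (x : U) :
    Cart.deriv (g.comp f) x = (Cart.deriv g (f x)).comp (Cart.deriv f x) := by
  have hx : (f x).1 = Cart.extend (U := U) (fun y => (f y).1) x.1 :=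
    (Cart.extend_apply (U := U) (fun y => (f y).1) x).symm
  have hg := Cart.hasFDerivAt g (f x)
  rw [hx] at hg
  refine (Cart.hasFDerivAt (g.comp f) x).unique
    ((hg.comp x.1 (Cart.hasFDerivAt f x)).congr_of_eventuallyEq ?_)
  filter_upwards [U.isOpen.mem_nhds x.2] with y hy
  have h1 := Cart.extend_apply (U := U) (fun y => ((g.comp f) y).1) ⟨y, hy⟩
  have h2 := Cart.extend_apply (U := U) (fun y => (f y).1) ⟨y, hy⟩
  have h3 := Cart.extend_apply (U := U') (fun y => (g y).1) (f ⟨y, hy⟩)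
  simp only [Function.comp] at *
  rw [h1, h2, h3]
  rfl

/-- Functors from `Cart` to the category of diffeological spaces. -/
structure CartFunctor where
  obj : Cart → Type
  diffeology : ∀ U, DiffeologicalSpace (obj U)
  map : ∀ {U U' : Cart}, SMap U U' → SMap (obj U) (obj U')
  map_id : ∀ (U : Cart) (x : obj U), map (SMap.id U) x = x
  map_comp : ∀ {U U' U'' : Cart} (g : SMap U' U'') (f : SMap U U') (x : obj U),
    map (g.comp f) x = map g (map f x)

attribute [instance] CartFunctor.diffeology

/-- Natural transformations between such functors. -/
structure CartTrans (F G : CartFunctor) where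
  app : ∀ U, SMap (F.obj U) (G.obj U)
  naturality : ∀ {U U' : Cart} (f : SMap U U') (x : F.obj U),
    app U' (F.map f x) = G.map f (app U x)

/-- Endofunctors of `Cart`. -/
structure CartEndo where
  obj : Cart → Cart
  map : ∀ {U U' : Cart}, SMap U U' → SMap (obj U) (obj U')
  map_id : ∀ (U : Cart) (x : obj U), map (SMap.id U) x = x
  map_comp : ∀ {U U' U'' : Cart} (g : SMap U' U'') (f : SMap U U') (x : obj U),
    map (g.comp f) x = map g (map f x)

/-- An endofunctor `F` of `Cart` followed by the embedding of `Cart` into diffeological spaces. -/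
def CartEndo.toDflg (F : CartEndo) : CartFunctor where
  obj U := F.obj U
  diffeology _ := inferInstance
  map := F.map
  map_id := F.map_id
  map_comp := F.map_comp

/-- The composite of two endofunctors, first `F`, then `G`. -/
def CartEndo.comp (G F : CartEndo) : CartEndo where
  obj U := G.obj (F.obj U)
  map f := G.map (F.map f)
  map_id U x := by
    have : F.map (SMap.id U) = SMap.id (F.obj U) := SMap.ext (F.map_id U)
    rw [this, G.map_id]
  map_comp g f x := by
    have : F.map (g.comp f) = (F.map g).comp (F.map f) := SMap.ext (F.map_comp g f)
    rw [this, G.map_comp]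

/-! ## The tangent functor on `Cart` -/

/-- `U × ℝⁿ`, as an open subset of `ℝⁿ⁺ⁿ`. -/
def tanObj (U : Cart) : Cart where
  dim := U.dim + U.dim
  carrier := {x | (EuclideanSpace.finAddEquivProd (𝕜 := ℝ) x).1 ∈ U.carrier}
  isOpen := U.isOpen.preimage (continuous_fst.comp EuclideanSpace.finAddEquivProd.continuous)

/-- The identification `ℝⁿ⁺ⁿ ≅ ℝⁿ × ℝⁿ`. -/
def split (U : Cart) : EuclideanSpace ℝ (Fin (tanObj U).dim) ≃L[ℝ]
    EuclideanSpace ℝ (Fin U.dim) × EuclideanSpace ℝ (Fin U.dim) :=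
  EuclideanSpace.finAddEquivProd

theorem mem_tanObj {U : Cart} {x : EuclideanSpace ℝ (Fin (tanObj U).dim)} :
    x ∈ (tanObj U).carrier ↔ (split U x).1 ∈ U.carrier := Iff.rfl

/-- The footprint `(u, v) ↦ u`. -/
def tanBase {U : Cart} (x : tanObj U) : U := ⟨(split U x.1).1, x.2⟩

/-- The vector part `(u, v) ↦ v`. -/
def tanVec {U : Cart} (x : tanObj U) : EuclideanSpace ℝ (Fin U.dim) := (split U x.1).2

/-- The point `(u, v)` of `U × ℝⁿ`. -/
def tanMk {U : Cart} (u : U) (v : EuclideanSpace ℝ (Fin U.dim)) : tanObj U :=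
  ⟨(split U).symm (u.1, v), by simp [mem_tanObj]⟩

theorem tanBase_mk {U : Cart} (u : U) (v : EuclideanSpace ℝ (Fin U.dim)) :
    tanBase (tanMk u v) = u := Subtype.ext (by simp [tanBase, tanMk])

theorem tanVec_mk {U : Cart} (u : U) (v : EuclideanSpace ℝ (Fin U.dim)) :
    tanVec (tanMk u v) = v := by simp [tanVec, tanMk]

theorem tanMk_base_vec {U : Cart} (x : tanObj U) : tanMk (tanBase x) (tanVec x) = x :=
  Subtype.ext (by simp [tanBase, tanMk, tanVec])

theorem dSmooth_tanBase (U : Cart) : DSmooth (tanBase (U := U)) := fun _ _ hp =>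
  contDiff_fst.comp ((split U).contDiff.comp (n := ∞) hp)

theorem dSmooth_tanVec (U : Cart) : DSmooth (tanVec (U := U)) := fun _ _ hp =>
  contDiff_snd.comp ((split U).contDiff.comp (n := ∞) hp)

theorem isPlot_tanMk {U : Cart} {n : ℕ} {p : EuclideanSpace ℝ (Fin n) → U}
    {q : EuclideanSpace ℝ (Fin n) → EuclideanSpace ℝ (Fin U.dim)} (hp : IsPlot p)
    (hq : IsPlot q) : IsPlot (fun t => tanMk (p t) (q t)) :=
  (split U).symm.contDiff.comp (n := ∞) (ContDiff.prodMk hp hq)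

/-- The tangent map `(u, v) ↦ (f(u), D_u f(v))`. -/
def tanMap {U U' : Cart} (f : SMap U U') : SMap (tanObj U) (tanObj U') where
  toFun x := tanMk (f (tanBase x)) (Cart.deriv f (tanBase x) (tanVec x))
  smooth n p hp := by
    refine isPlot_tanMk (f.smooth _ _ (dSmooth_tanBase U _ _ hp)) ?_
    have h1 : ContDiffOn ℝ ∞ (fderiv ℝ (Cart.extend fun y => (f y).1)) U.carrier :=
      (Cart.contDiffOn_map f).fderiv_of_isOpen U.isOpen (by simp)
    have hb : ContDiff ℝ ∞ (fun t => (tanBase (p t)).1) := dSmooth_tanBase U _ _ hp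
    have hv : ContDiff ℝ ∞ (fun t => tanVec (p t)) := dSmooth_tanVec U _ _ hp
    exact (h1.comp_contDiff hb fun t => (tanBase (p t)).2).clm_apply hv

theorem tanMap_apply {U U' : Cart} (f : SMap U U') (x : tanObj U) :
    tanMap f x = tanMk (f (tanBase x)) (Cart.deriv f (tanBase x) (tanVec x)) := rfl

/-- The tangent functor `T̂` on `Cart`. -/
def tanHat : CartEndo where
  obj := tanObj
  map := tanMap
  map_id U x := by
    rw [tanMap_apply, Cart.deriv_id]
    exact tanMk_base_vec x
  map_comp g f x := by
    simp only [tanMap_apply, Cart.deriv_comp, tanBase_mk, tanVec_mk]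
    rfl

/-- The second tangent functor `T̂² = T̂ ∘ T̂` on `Cart`. -/
def tanHatSq : CartEndo := tanHat.comp tanHat

/-- The map induced by `T̂f` on `k`-fold fibre powers. -/
def tanPowMap {U U' : Cart} (f : SMap U U') (k : ℕ) :
    SMap (FiberPow (tanBase (U := U)) k) (FiberPow (tanBase (U := U')) k) where
  toFun z := ⟨(f z.1.1, fun i => tanMap f (z.1.2 i)), fun i =>
    (tanBase_mk _ _).trans (congrArg f (z.2 i))⟩
  smooth _ _ hp := ⟨f.smooth _ _ hp.1, fun i => (tanMap f).smooth _ _ (hp.2 i)⟩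

/-- The `k`-fold fibre power `T̂_k = T̂ ×_π̂ ⋯ ×_π̂ T̂`. -/
def tanHatPow (k : ℕ) : CartFunctor where
  obj U := FiberPow (tanBase (U := U)) k
  diffeology _ := inferInstance
  map f := tanPowMap f k
  map_id U x := Subtype.ext (Prod.ext rfl (funext fun i => tanHat.map_id U (x.1.2 i)))
  map_comp g f x := Subtype.ext (Prod.ext rfl (funext fun i => tanHat.map_comp g f (x.1.2 i)))

theorem deriv_tanMap {U U' : Cart} (f : SMap U U') (x : tanObj U)
    (y : EuclideanSpace ℝ (Fin (tanObj U).dim)) :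
    Cart.deriv (tanMap f) x y = (split U').symm
      (Cart.deriv f (tanBase x) (split U y).1,
        fderiv ℝ (fderiv ℝ (Cart.extend fun y => (f y).1)) (tanBase x).1 (split U y).1
          (tanVec x) + Cart.deriv f (tanBase x) (split U y).2) := by
  set F := Cart.extend (U := U) fun y => (f y).1 with hF
  have h1 : ContDiffAt ℝ ∞ (fderiv ℝ F) (tanBase x).1 :=
    ((Cart.contDiffOn_map f).fderiv_of_isOpen U.isOpen (by simp)).contDiffAt
      (U.isOpen.mem_nhds (tanBase x).2)
  have hfst : HasFDerivAt (fun z => (split U z).1)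
      ((ContinuousLinearMap.fst ℝ _ _).comp (split U).toContinuousLinearMap) x.1 :=
    (hasFDerivAt_fst.comp x.1 (split U).hasFDerivAt)
  have hsnd : HasFDerivAt (fun z => (split U z).2)
      ((ContinuousLinearMap.snd ℝ _ _).comp (split U).toContinuousLinearMap) x.1 :=
    (hasFDerivAt_snd.comp x.1 (split U).hasFDerivAt)
  have h2 : HasFDerivAt (fderiv ℝ F) (fderiv ℝ (fderiv ℝ F) (tanBase x).1)
      (split U x.1).1 := (h1.differentiableAt (by simp)).hasFDerivAt
  have h3 : HasFDerivAt F (Cart.deriv f (tanBase x)) (split U x.1).1 :=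
    Cart.hasFDerivAt f (tanBase x)
  have h4 := (split U').symm.hasFDerivAt.comp x.1
    ((h3.comp x.1 hfst).prodMk ((h2.comp x.1 hfst).clm_apply hsnd))
  have h5 := (Cart.hasFDerivAt (tanMap f) x).unique (h4.congr_of_eventuallyEq (by
    filter_upwards [(tanObj U).isOpen.mem_nhds x.2] with z hz
    have e1 := Cart.extend_apply (U := tanObj U) (fun y => (tanMap f y).1) ⟨z, hz⟩
    have e2 := Cart.extend_apply (U := U) (fun y => (f y).1) (tanBase ⟨z, hz⟩)
    refine e1.trans ?_
    simp only [Function.comp]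
    rw [show F (split U z).1 = (f (tanBase ⟨z, hz⟩)).1 from e2]
    rfl))
  rw [h5]
  refine congrArg (split U').symm (Prod.ext rfl ?_)
  exact add_comm (Cart.deriv f (tanBase x) (split U y).2) _

/-- The symmetric structure `τ̂ : (u, v₀, v₁, v₀₁) ↦ (u, v₁, v₀, v₀₁)`. -/
def flipHat : CartTrans tanHatSq.toDflg tanHatSq.toDflg where
  app U :=
    { toFun := fun z : tanObj (tanObj U) =>
        (tanMk (tanMk (tanBase (tanBase z)) (split U (tanVec z)).1)
          ((split U).symm (tanVec (tanBase z), (split U (tanVec z)).2)) :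
          tanObj (tanObj U))
      smooth := fun n p hp => by
        have hb := dSmooth_tanBase (tanObj U) _ _ hp
        have hv : ContDiff ℝ ∞ _ :=
          (split U).contDiff.comp (n := ∞) (dSmooth_tanVec (tanObj U) _ _ hp)
        exact isPlot_tanMk (U := tanObj U)
          (isPlot_tanMk (dSmooth_tanBase U _ _ hb) (contDiff_fst.comp hv))
          ((split U).symm.contDiff.comp (n := ∞)
            (ContDiff.prodMk (dSmooth_tanVec U _ _ hb) (contDiff_snd.comp hv))) }
  naturality {U U'} f z := by
    change tanObj (tanObj U) at z
    change tanMk (U := tanObj U') (tanMk (tanBase (tanBase (tanMap (tanMap f) z)))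
          (split U' (tanVec (tanMap (tanMap f) z))).1)
          ((split U').symm (tanVec (tanBase (tanMap (tanMap f) z)),
            (split U' (tanVec (tanMap (tanMap f) z))).2)) =
      tanMap (tanMap f) (tanMk (U := tanObj U)
        (tanMk (tanBase (tanBase z)) (split U (tanVec z)).1)
          ((split U).symm (tanVec (tanBase z), (split U (tanVec z)).2)))
    have hsymm : ∀ (u : U) (a b : EuclideanSpace ℝ (Fin U.dim)),
        fderiv ℝ (fderiv ℝ (Cart.extend fun y => (f y).1)) u.1 a b =
        fderiv ℝ (fderiv ℝ (Cart.extend fun y => (f y).1)) u.1 b a := fun u a b =>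
      (((Cart.contDiffOn_map f).contDiffAt (U.isOpen.mem_nhds u.2)).isSymmSndFDerivAt
        (by rw [minSmoothness_of_isRCLikeNormedField]
            exact WithTop.coe_le_coe.2 (le_top : (2 : ℕ∞) ≤ ⊤))) a b
    simp only [tanMap_apply (tanMap f), tanBase_mk, tanVec_mk, deriv_tanMap, tanMap_apply f]
    simp only [ContinuousLinearEquiv.apply_symm_apply]
    rw [hsymm]

/-- The vertical lift `λ̂ : (u, v) ↦ (u, 0, 0, v)`. -/
def liftHat : CartTrans tanHat.toDflg tanHatSq.toDflg where
  app U :=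
    { toFun := fun z : tanObj U =>
        (tanMk (tanMk (tanBase z) 0) ((split U).symm (0, tanVec z)) : tanObj (tanObj U))
      smooth := fun n p hp => by
        exact isPlot_tanMk (U := tanObj U)
          (isPlot_tanMk (dSmooth_tanBase U _ _ hp) isPlot_const)
          ((split U).symm.contDiff.comp (n := ∞)
            (ContDiff.prodMk contDiff_const (dSmooth_tanVec U _ _ hp))) }
  naturality {U U'} f z := by
    change tanObj U at z
    change tanMk (U := tanObj U') (tanMk (tanBase (tanMap f z)) 0)
        ((split U').symm (0, tanVec (tanMap f z))) =
      tanMap (tanMap f) (tanMk (U := tanObj U) (tanMk (tanBase z) 0)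
        ((split U).symm (0, tanVec z)))
    simp only [tanMap_apply (tanMap f), tanBase_mk, tanVec_mk, deriv_tanMap, tanMap_apply f]
    simp only [ContinuousLinearEquiv.apply_symm_apply, map_zero, zero_add]

/-! ## Left Kan extension to diffeological spaces -/

section Kan

variable (F : CartFunctor) (X : Type u) [DiffeologicalSpace X]

/-- The points of the coproduct `∐_{(U, p)} F U` over all plots `p : U → X`. -/
def KanPre : Type u := Σ U : Cart, SMap U X × F.obj U

/-- The relation on the coproduct given by the morphisms `f : (U, p' ∘ f) → (U', p')` between
plots. -/
inductive KanRel : KanPre F X → KanPre F X → Prop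
  | mk {U U' : Cart} (f : SMap U U') (p' : SMap U' X) (x : F.obj U) :
      KanRel ⟨U, p'.comp f, x⟩ ⟨U', p', F.map f x⟩

/-- The left Kan extension of `F` at `X`: the colimit of `F U` over the category of plots
`p : U → X`, that is, the quotient of the coproduct by the equivalence relation generated by
`KanRel`. -/
def Kan : Type u := Quot (KanRel F X)

variable {F X}

/-- The class `p_* x`, for a plot `p : U → X` and `x` in `F U`. -/
def Kan.mk {U : Cart} (p : SMap U X) (x : F.obj U) : Kan F X := Quot.mk _ ⟨U, p, x⟩

theorem Kan.mk_comp {U U' : Cart} (f : SMap U U') (p' : SMap U' X) (x : F.obj U) :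
    Kan.mk (p'.comp f) x = Kan.mk p' (F.map f x) := Quot.sound (KanRel.mk f p' x)

theorem Kan.ind {P : Kan F X → Prop}
    (h : ∀ (U : Cart) (p : SMap U X) (x : F.obj U), P (Kan.mk p x)) (z : Kan F X) : P z := by
  obtain ⟨⟨U, p, x⟩, rfl⟩ := Quot.exists_rep z
  exact h U p x

variable (F X) in
/-- The colimit diffeology: the finest one for which all the maps `x ↦ p_* x` are smooth. -/
instance : DiffeologicalSpace (Kan F X) :=
  DiffeologicalSpace.generateFrom {q | ∃ (n : ℕ) (U : Cart) (p : SMap U X)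
    (a : EuclideanSpace ℝ (Fin n) → F.obj U), IsPlot a ∧ q = ⟨n, fun t => Kan.mk p (a t)⟩}

theorem Kan.dSmooth_mk {U : Cart} (p : SMap U X) :
    DSmooth (fun x : F.obj U => Kan.mk p x) := fun n a ha =>
  DiffeologicalSpace.isPlot_generatedFrom_of_mem
    (p := fun t => Kan.mk p (a t)) ⟨n, U, p, a, ha, rfl⟩

theorem Kan.dSmooth_of {Y : Type v} [dY : DiffeologicalSpace Y] {g : Kan F X → Y}
    (h : ∀ (U : Cart) (p : SMap U X), DSmooth (fun x : F.obj U => g (Kan.mk p x))) :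
    DSmooth g := by
  intro n q hq
  refine hq (inducedDiffeology g) ?_
  rintro _ ⟨m, U, p, a, ha, rfl⟩
  exact h U p m a ha

/-- The map `LF(g) : LF(X) → LF(Y)`, `p_* x ↦ (g ∘ p)_* x`. -/
def Kan.map (F : CartFunctor) {X : Type u} {Y : Type v} [DiffeologicalSpace X]
    [DiffeologicalSpace Y] (g : SMap X Y) : SMap (Kan F X) (Kan F Y) where
  toFun := Quot.lift (fun z => Kan.mk (g.comp z.2.1) z.2.2) (by
    rintro _ _ ⟨f, p', x⟩
    exact Kan.mk_comp f (g.comp p') x)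
  smooth := Kan.dSmooth_of fun U p => Kan.dSmooth_mk (g.comp p)

theorem Kan.map_mk {X : Type u} {Y : Type v} [DiffeologicalSpace X] [DiffeologicalSpace Y]
    (g : SMap X Y) {U : Cart} (p : SMap U X) (x : F.obj U) :
    Kan.map F g (Kan.mk p x) = Kan.mk (g.comp p) x := rfl

/-- The map `(Lα)_X : LF(X) → LG(X)`, `p_* x ↦ p_* (α_U x)`. -/
def Kan.trans {F G : CartFunctor} (α : CartTrans F G) (X : Type u) [DiffeologicalSpace X] :
    SMap (Kan F X) (Kan G X) where
  toFun := Quot.lift (fun z => Kan.mk z.2.1 (α.app z.1 z.2.2)) (by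
    rintro _ _ ⟨f, p', x⟩
    simp only [α.naturality]
    exact Kan.mk_comp f p' (α.app _ x))
  smooth := Kan.dSmooth_of fun U p => (Kan.dSmooth_mk p).comp (α.app U).smooth

end Kan

/-! ## The tangent structure on diffeological spaces -/

section Tangent

variable (X : Type u) [DiffeologicalSpace X]

/-- The tangent bundle `TX`: the left Kan extension of `T̂`. -/
abbrev Tan : Type u := Kan tanHat.toDflg X

/-- The tangent map `Tf`, `p_* v ↦ (f ∘ p)_* v`. -/
abbrev Tan.map {X : Type u} {Y : Type v} [DiffeologicalSpace X] [DiffeologicalSpace Y]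
    (f : SMap X Y) : SMap (Tan X) (Tan Y) := Kan.map tanHat.toDflg f

/-- The footprint `π : TX → X`, `p_*(u, v) ↦ p(u)`. -/
def footprint : SMap (Tan X) X where
  toFun := Quot.lift (fun z => z.2.1 (tanBase z.2.2)) (by
    rintro _ _ ⟨f, p', x⟩
    exact congrArg p' (tanBase_mk (f (tanBase x)) _).symm)
  smooth := Kan.dSmooth_of fun U p => p.smooth.comp (dSmooth_tanBase U)

/-- The `k`-fold fibre power `T_k X` of `TX` over `X`. -/
abbrev TanPow (k : ℕ) : Type u := FiberPow (footprint X) k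

/-- `θ_k : LT̂_k(X) → T_k X`, `p_*(u, v₀, …, v_{k-1}) ↦ (p_* v₀, …, p_* v_{k-1})`. -/
def theta (k : ℕ) : SMap (Kan (tanHatPow k) X) (TanPow X k) where
  toFun := Quot.lift
    (fun z => ⟨(z.2.1 z.2.2.1.1, fun i => Kan.mk z.2.1 (z.2.2.1.2 i)), fun i =>
      congrArg z.2.1 (z.2.2.2 i)⟩) (by
    rintro _ _ ⟨f, p', x⟩
    exact Subtype.ext (Prod.ext rfl (funext fun i =>
      Kan.mk_comp (F := tanHat.toDflg) f p' (x.1.2 i))))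
  smooth := Kan.dSmooth_of fun U p n a ha =>
    ⟨p.smooth _ _ ha.1, fun i => Kan.dSmooth_mk (F := tanHat.toDflg) p _ _ (ha.2 i)⟩

variable {X} in
/-- The tangent map `Tp : T̂U → TX` of a plot `p : U → X`, again a plot. -/
def tanPlot {U : Cart} (p : SMap U X) : SMap (tanObj U) (Tan X) :=
  ⟨fun x => Kan.mk (F := tanHat.toDflg) p x, Kan.dSmooth_mk (F := tanHat.toDflg) p⟩

/-- `θ² : LT̂²(X) → T²X`, `p_* x ↦ T²p(x) = (Tp)_* x` for `x` in `T̂²U = T̂(T̂U)`. -/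
def thetaSq : SMap (Kan tanHatSq.toDflg X) (Tan (Tan X)) where
  toFun := Quot.lift
    (fun z => Kan.mk (F := tanHat.toDflg) (U := tanObj z.1) (tanPlot z.2.1) z.2.2) (by
    rintro _ _ ⟨f, p', x⟩
    have : tanPlot (p'.comp f) = (tanPlot p').comp (tanMap f) :=
      SMap.ext fun y => Kan.mk_comp (F := tanHat.toDflg) f p' y
    simp only [this]
    exact Kan.mk_comp (F := tanHat.toDflg) (tanMap f) (tanPlot p') x)
  smooth := Kan.dSmooth_of fun U p => Kan.dSmooth_mk (F := tanHat.toDflg) (tanPlot p)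

/-- The vertical lift `λ_X = θ² ∘ Lλ̂ : TX → T²X`. -/
def vlift : SMap (Tan X) (Tan (Tan X)) := (thetaSq X).comp (Kan.trans liftHat X)

/-- `ν_k : T(T_k X) → T²X ×_{TX} ⋯ ×_{TX} T²X`, `(p₁, …, p_k)_* v ↦ ((p₁)_* v, …, (p_k)_* v)`, the
fibre product being taken over `Tπ`. -/
def nu (k : ℕ) (z : Tan (TanPow X k)) : FiberPow (Tan.map (footprint X)) k :=
  ⟨(Tan.map (FiberPow.base (footprint X) k) z,
    fun i => Tan.map (FiberPow.proj (footprint X) k i) z), fun i => by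
      induction z using Kan.ind with
      | h U p x =>
        have : (footprint X).comp ((FiberPow.proj (footprint X) k i).comp p) =
            (FiberPow.base (footprint X) k).comp p := SMap.ext fun y => (p y).2 i
        exact congrArg (fun q => Kan.mk (F := tanHat.toDflg) q x) this⟩

/-- The axioms (E1) to (E4):
(E1) `θ_k` is an isomorphism of diffeological spaces for all `k ≥ 1`;
(E2) there is a canonical flip, i.e. a smooth `τ : T²X → T²X` with `τ ∘ θ² = θ² ∘ Lτ̂`;
(E3) the vertical lift is an induction;
(E4) `ν_k` is injective for all `k ≥ 1`. -/
structure PreElastic : Prop where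
  e1 : ∀ k : ℕ, 1 ≤ k → IsDiffeomorphism (theta X k)
  e2 : ∃ τ : SMap (Tan (Tan X)) (Tan (Tan X)), ∀ z : Kan tanHatSq.toDflg X,
    τ (thetaSq X z) = thetaSq X (Kan.trans flipHat X z)
  e3 : IsInduction (vlift X)
  e4 : ∀ k : ℕ, 1 ≤ k → Function.Injective (nu X k)

end Tangent

/-- Bundled diffeological spaces. -/
structure Dflg where
  carrier : Type u
  diffeology : DiffeologicalSpace carrier

attribute [instance] Dflg.diffeology

/-- The object `T_k X` for a bundled diffeological space `X`. -/
def Dflg.tanPow (k : ℕ) (X : Dflg.{u}) : Dflg.{u} := ⟨TanPow X.carrier k, inferInstance⟩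

/-- Elastic diffeological spaces: `X` satisfies (E1) to (E4), and (E5) so do all the spaces
`T_{k₁} ⋯ T_{kₙ} X` (for `ks = [k₁, …, kₙ]`). -/
def IsElastic (X : Type u) [d : DiffeologicalSpace X] : Prop :=
  PreElastic X ∧ ∀ ks : List ℕ, PreElastic (ks.foldr Dflg.tanPow (Dflg.mk X d)).carrier

/-! ## Convenient diffeological vector spaces -/

section Convenient

variable (V : Type u) [AddCommGroup V] [Module ℝ V] [d : DiffeologicalSpace V]

/-- Diffeological vector spaces over `ℝ`. -/
class DiffeologicalVectorSpace : Prop where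
  dSmooth_add : DSmooth fun z : V × V => z.1 + z.2
  dSmooth_smul : DSmooth fun z : ℝ × V => z.1 • z.2

/-- `L^∞(V)`: the smooth linear functionals on `V`. -/
def smoothDual : Set (V →ₗ[ℝ] ℝ) := {l | DSmooth l}

/-- The diffeology `Π L` determined by a set `L` of real-valued functions. -/
abbrev determinedBy {X : Type u} (L : Set (X → ℝ)) : DiffeologicalSpace X where
  plots n := {p | ∀ l ∈ L, IsPlot (l ∘ p)}
  constant_plots x := fun _ _ => isPlot_const
  plot_reparam hp hf := fun l hl => isPlot_reparam (hp l hl) hf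
  locality {n p} hp := fun l hl => by
    refine DiffeologicalSpace.locality (X := ℝ) fun x => ?_
    obtain ⟨s, hs, hx, h⟩ := hp x
    exact ⟨s, hs, hx, fun {m f} h1 h2 => h h1 h2 l hl⟩

/-- `V` is pre-convenient: its diffeology is `Π L^∞(V)`. -/
def IsPreConvenient : Prop :=
  d = determinedBy {φ : V → ℝ | ∃ l ∈ smoothDual V, φ = l}

/-- `V` is linearly separated: `L^∞(V)` separates points. -/
def IsLinearlySeparated : Prop :=
  ∀ x y : V, (∀ l ∈ smoothDual V, l x = l y) → x = y

variable {V} in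
/-- The curve `c` is weakly differentiable with weak derivative `c'`. -/
def HasWeakDeriv (c c' : ℝ → V) : Prop :=
  ∀ l ∈ smoothDual V, ∀ t : ℝ, HasDerivAt (fun s => l (c s)) (l (c' t)) t

variable {V} in
/-- The curve `c` is infinitely weakly differentiable: it has iterated weak derivatives
`c = c₀, c₁, c₂, …` of all orders. -/
def IsInfWeaklyDiff (c : ℝ → V) : Prop :=
  ∃ D : ℕ → ℝ → V, D 0 = c ∧ ∀ k, HasWeakDeriv (D k) (D (k + 1))

/-- `V` is convenient: pre-convenient, linearly separated, and every smooth curve in `V` is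
infinitely weakly differentiable. -/
structure IsConvenient : Prop where
  preConvenient : IsPreConvenient V
  separated : IsLinearlySeparated V
  smooth_curve : ∀ c : ℝ → V, DSmooth c → IsInfWeaklyDiff c

end Convenient

end ElasticDflg

end

open scoped ContDiff

noncomputable section

namespace ElasticDflg

open Diffeology

universe u v w

/-! ## Hadamard's lemma with parameters -/

/-! The point is that a convenient space `V` has global tangent coordinates: `TV ≅ V × V` by `p_*(u,
v) ↦ (p(u), D_u p(v))`, and likewise `(LT̂_k)V ≅ V × Vᵏ`. The weak derivative `D_u p(v)` is an
element of `V` because smooth curves have weak derivatives. It is determined by the numbers `D_u(l ∘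
p)(v)`, since functionals separate points, and it varies smoothly, since functionals detect plots.
The chain rule lets it descend to the colimit.

The inverse sends `(x, w)` to the standard frame at `0` along the affine plot `s ↦ x + ∑ sᵢ wᵢ`.
What must be proved is that every class arises this way (`IsConvenient.affTan_surjective`). After
pulling back to `ℝᵏ`, Hadamard's lemma applied twice gives `p(s) = x + ∑ sᵢ wᵢ + ∑ sᵢ sⱼ hᵢⱼ(s)`
with plots `hᵢⱼ`. Replace the products `sᵢ sⱼ` by independent variables `rᵢⱼ`: the plot `p` and its
affine part become the restrictions of one plot `Q(s, r)` along `s ↦ (s, s sᵀ)` and `s ↦ (s, 0)`.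
These have the same first-order jet at `0`, so the two classes coincide. Hadamard's lemma itself
passes from `ℝ` to `V` because the only missing value of the difference quotient is a weak
derivative.

In coordinates the axioms become visible. Both sides of `θ_k` are `V × Vᵏ`. On `T²V ≅ V⁴` the flip
exchanges the two middle entries, by symmetry of second derivatives, and the vertical lift is `(x,
w) ↦ (x, 0, 0, w)`, which has a smooth retraction. Injectivity of `ν_k` says that a tangent vector
to `V × Vᵏ` is determined by its components. Finally `T_k V ≅ V × Vᵏ` is convenient again, so
iterating `T_k` costs nothing. -/

theorem contDiff_intervalIntegral_param_nat {E : Type u} [NormedAddCommGroup E] [NormedSpace ℝ E]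
    [FiniteDimensional ℝ E] (n : ℕ) : ∀ {F : Type u} [NormedAddCommGroup F] [NormedSpace ℝ F]
      {f : E × ℝ → F}, ContDiff ℝ n f → ContDiff ℝ n fun x => ∫ r in (0 : ℝ)..1, f (x, r) := by
  induction n with
  | zero =>
    intro F _ _ f hf
    have hc : Continuous f := hf.continuous
    exact contDiff_zero.2
      (intervalIntegral.continuous_parametric_intervalIntegral_of_continuous' (f := fun x r => f (x, r))
        hc 0 1)
  | succ n ih =>
    intro F _ _ f hf
    have hf' : ContDiff ℝ (n + 1) f := by exact_mod_cast hf
    have hd : Differentiable ℝ f := hf'.differentiable (by simp)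
    have hfd : ContDiff ℝ n (fderiv ℝ f) := hf'.fderiv_right le_rfl
    set f' : E × ℝ → E →L[ℝ] F := fun z => (fderiv ℝ f z).comp (ContinuousLinearMap.inl ℝ E ℝ)
    have hf'c : ContDiff ℝ n f' := hfd.clm_comp contDiff_const
    have hcont : Continuous f' := hf'c.continuous
    push_cast
    refine contDiff_succ_iff_hasFDerivAt.2
      -- The derivative integrates a function with values in `E →L[ℝ] F`, so the induction must run
      -- over all targets at once. For this `E` and `F` share a universe.
      ⟨fun x => ∫ r in (0 : ℝ)..1, f' (x, r), ih hf'c, fun x => ?_⟩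
    -- A constant dominates the partial derivative, by compactness of the unit ball around `x` times
    -- `[0, 1]`.
    obtain ⟨C, hC⟩ := ((isCompact_closedBall x 1).prod
      (isCompact_Icc (a := (0 : ℝ)) (b := 1))).exists_bound_of_continuousOn hcont.continuousOn
    refine intervalIntegral.hasFDerivAt_integral_of_dominated_of_fderiv_le
      (F := fun x r => f (x, r)) (F' := fun x r => f' (x, r)) (bound := fun _ => C)
      (Metric.closedBall_mem_nhds x one_pos) ?_ ?_ ?_ ?_ ?_ ?_
    · exact Filter.Eventually.of_forall fun y =>
        (hd.continuous.comp (Continuous.prodMk_right y)).aestronglyMeasurable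
    · exact (hd.continuous.comp (Continuous.prodMk_right x)).intervalIntegrable _ _
    · exact (hcont.comp (Continuous.prodMk_right x)).aestronglyMeasurable
    · refine Filter.Eventually.of_forall fun t ht y hy => hC _ ⟨hy, ?_⟩
      rw [Set.uIoc_of_le zero_le_one] at ht
      exact ⟨ht.1.le, ht.2⟩
    · exact intervalIntegrable_const
    · refine Filter.Eventually.of_forall fun t _ y _ => ?_
      exact (hd (y, t)).hasFDerivAt.comp y (hasFDerivAt_prodMk_left y t)

theorem contDiff_intervalIntegral_param {E F : Type u} [NormedAddCommGroup E] [NormedSpace ℝ E]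
    [FiniteDimensional ℝ E] [NormedAddCommGroup F] [NormedSpace ℝ F]
    {f : E × ℝ → F} (hf : ContDiff ℝ ∞ f) :
    ContDiff ℝ ∞ fun x => ∫ r in (0 : ℝ)..1, f (x, r) :=
  contDiff_infty.2 fun n => contDiff_intervalIntegral_param_nat n (contDiff_infty.1 hf n)

/-- Hadamard's lemma: the difference quotient of a smooth function in one of its variables extends
smoothly over the diagonal. -/
theorem exists_contDiff_slope {E : Type} [NormedAddCommGroup E] [NormedSpace ℝ E]
    [FiniteDimensional ℝ E] {f : E × ℝ → ℝ} (hf : ContDiff ℝ ∞ f) :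
    ∃ g : E × ℝ → ℝ, ContDiff ℝ ∞ g ∧ (∀ x t, f (x, t) = f (x, 0) + t * g (x, t)) ∧
      ∀ x, g (x, 0) = fderiv ℝ f (x, 0) (0, 1) := by
  have hd : Differentiable ℝ f := hf.differentiable (by simp)
  have hfd : ContDiff ℝ ∞ fun z => fderiv ℝ f z (0, 1) :=
    (hf.fderiv_right (by simp)).clm_apply contDiff_const
  -- The witness is `g(x, t) = ∫₀¹ ∂ₜf(x, rt) dr`, which is defined without dividing by `t`.
  refine ⟨fun z => ∫ r in (0 : ℝ)..1, fderiv ℝ f (z.1, r * z.2) (0, 1),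
    contDiff_intervalIntegral_param (f := fun y : (E × ℝ) × ℝ =>
      fderiv ℝ f (y.1.1, y.2 * y.1.2) (0, 1)) (hfd.comp (by fun_prop)), fun x t => ?_, fun x => ?_⟩
  · have h1 : ∀ r ∈ Set.uIcc (0 : ℝ) 1, HasDerivAt (fun r => f (x, r * t))
        (t * fderiv ℝ f (x, r * t) (0, 1)) r := fun r _ => by
      have h2 : HasDerivAt (fun r => ((x, r * t) : E × ℝ)) (0, t) r :=
        (hasDerivAt_const r x).prodMk (by simpa using (hasDerivAt_id r).mul_const t)
      have h3 := (hd (x, r * t)).hasFDerivAt.comp_hasDerivAt r h2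
      have h4 : ((0, t) : E × ℝ) = t • (0, 1) := by simp
      rw [h4, map_smul, smul_eq_mul] at h3
      exact h3
    have h5 := intervalIntegral.integral_eq_sub_of_hasDerivAt h1
      ((continuous_const.mul (hfd.continuous.comp (by fun_prop))).intervalIntegrable _ _)
    rw [intervalIntegral.integral_const_mul] at h5
    simp only [one_mul, zero_mul] at h5
    simp only [h5]
    ring
  · simp

/-! ## Weakly smooth maps and convenient spaces -/

section WeaklySmooth

variable {V : Type u} [AddCommGroup V] [Module ℝ V] [DiffeologicalSpace V]

/-- Maps from a normed space that become smooth after composition with smooth functionals. -/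
def WeaklySmooth {E : Type v} [NormedAddCommGroup E] [NormedSpace ℝ E] (f : E → V) : Prop :=
  ∀ l ∈ smoothDual V, ContDiff ℝ ∞ fun x => l (f x)

section

variable {E : Type v} [NormedAddCommGroup E] [NormedSpace ℝ E]
  {E' : Type w} [NormedAddCommGroup E'] [NormedSpace ℝ E']

theorem WeaklySmooth.comp {f : E → V} (hf : WeaklySmooth f) {g : E' → E} (hg : ContDiff ℝ ∞ g) :
    WeaklySmooth fun x => f (g x) := fun l hl => (hf l hl).comp hg

theorem WeaklySmooth.const (x : V) : WeaklySmooth fun _ : E => x := fun _ _ => contDiff_const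

theorem WeaklySmooth.add {f g : E → V} (hf : WeaklySmooth f) (hg : WeaklySmooth g) :
    WeaklySmooth fun x => f x + g x := fun l hl => by
  simpa only [map_add] using (hf l hl).add (hg l hl)

theorem WeaklySmooth.smul {a : E → ℝ} {f : E → V} (ha : ContDiff ℝ ∞ a) (hf : WeaklySmooth f) :
    WeaklySmooth fun x => a x • f x := fun l hl => by
  simpa only [map_smul, smul_eq_mul] using ha.mul (hf l hl)

theorem WeaklySmooth.sum {ι : Type*} {s : Finset ι} {f : ι → E → V}
    (hf : ∀ i ∈ s, WeaklySmooth (f i)) : WeaklySmooth fun x => ∑ i ∈ s, f i x := fun l hl => by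
  simpa only [map_sum] using ContDiff.sum fun i hi => hf i hi l hl

end

theorem isPlot_comp_of_mem_smoothDual {l : V →ₗ[ℝ] ℝ} (hl : l ∈ smoothDual V) {n : ℕ}
    {p : EuclideanSpace ℝ (Fin n) → V} (hp : IsPlot p) : ContDiff ℝ ∞ fun x => l (p x) :=
  hl n p hp

theorem IsConvenient.isPlot_iff (hV : IsConvenient V) {n : ℕ}
    {p : EuclideanSpace ℝ (Fin n) → V} : IsPlot p ↔ WeaklySmooth p := by
  refine ⟨fun hp l hl => isPlot_comp_of_mem_smoothDual hl hp, fun hp => ?_⟩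
  have h : @IsPlot V (determinedBy {φ : V → ℝ | ∃ l ∈ smoothDual V, φ = l}) n p := by
    rintro _ ⟨l, hl, rfl⟩
    exact hp l hl
  have h2 := hV.preConvenient
  unfold IsPreConvenient at h2
  rw [← h2] at h
  exact h

theorem IsConvenient.ext (hV : IsConvenient V) {x y : V}
    (h : ∀ l ∈ smoothDual V, l x = l y) : x = y := hV.separated x y h

theorem IsConvenient.dSmooth (hV : IsConvenient V) {E : Type v} [NormedAddCommGroup E]
    [NormedSpace ℝ E] [DiffeologicalSpace E] [IsContDiffCompatible E] {f : E → V}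
    (hf : WeaklySmooth f) : DSmooth f :=
  fun _ _ hp => hV.isPlot_iff.2 (hf.comp hp.contDiff)

theorem IsConvenient.exists_hasDerivAt (hV : IsConvenient V) {c : ℝ → V} (hc : WeaklySmooth c)
    (t : ℝ) : ∃ w : V, ∀ l ∈ smoothDual V, HasDerivAt (fun s => l (c s)) (l w) t := by
  obtain ⟨D, rfl, hD⟩ := hV.smooth_curve c (hV.dSmooth hc)
  exact ⟨D 1 t, fun l hl => hD 0 l hl t⟩

/-- Translating curves moves the derivative from `0` to any time. The resulting weak derivative `c'`
is again weakly smooth because `l ∘ c' = (l ∘ c)'`, so the construction can be iterated. -/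
theorem isInfWeaklyDiff_of_exists_hasDerivAt
    (hd : ∀ c : ℝ → V, WeaklySmooth c →
      ∃ w : V, ∀ l ∈ smoothDual V, HasDerivAt (fun s => l (c s)) (l w) 0)
    {c : ℝ → V} (hc : WeaklySmooth c) : IsInfWeaklyDiff c := by
  have key : ∀ c : {c : ℝ → V // WeaklySmooth c},
      ∃ c' : {c : ℝ → V // WeaklySmooth c}, HasWeakDeriv c.1 c'.1 := by
    rintro ⟨c, hc⟩
    have h1 : ∀ t, ∃ w : V, ∀ l ∈ smoothDual V, HasDerivAt (fun s => l (c s)) (l w) t := fun t => by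
      obtain ⟨w, hw⟩ := hd (fun s => c (t + s)) (hc.comp (contDiff_const.add contDiff_id))
      refine ⟨w, fun l hl => ?_⟩
      have h2 : HasDerivAt (fun s => l (c (t + s))) (l w) (t - t) := by
        rw [sub_self]
        exact hw l hl
      simpa using h2.comp_sub_const t t
    choose c' hc' using h1
    refine ⟨⟨c', fun l hl => ?_⟩, fun l hl t => hc' t l hl⟩
    have h4 : (fun t => l (c' t)) = deriv fun s => l (c s) := funext fun t => (hc' t l hl).deriv.symm
    rw [h4]
    exact (contDiff_infty_iff_deriv.1 (hc l hl)).2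
  choose d hd' using key
  refine ⟨fun k => (d^[k] ⟨c, hc⟩).1, rfl, fun k => ?_⟩
  simp only [Function.iterate_succ', Function.comp]
  exact hd' _

/-- A criterion for convenience using only some of the smooth functionals. -/
theorem IsConvenient.of (S : Set (V →ₗ[ℝ] ℝ)) (hS : S ⊆ smoothDual V)
    (hp : ∀ (n : ℕ) (p : EuclideanSpace ℝ (Fin n) → V),
      (∀ l ∈ S, ContDiff ℝ ∞ fun x => l (p x)) → IsPlot p)
    (hs : ∀ x y : V, (∀ l ∈ S, l x = l y) → x = y)
    (hd : ∀ c : ℝ → V, WeaklySmooth c →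
      ∃ w : V, ∀ l ∈ smoothDual V, HasDerivAt (fun s => l (c s)) (l w) 0) :
    IsConvenient V where
  preConvenient := by
    unfold IsPreConvenient
    ext n p
    refine ⟨?_, fun h => hp n p fun l hl => h l ⟨l, hS hl, rfl⟩⟩
    rintro h _ ⟨l, hl, rfl⟩
    exact hl n p h
  separated x y h := hs x y fun l hl => h l (hS hl)
  smooth_curve c hc := isInfWeaklyDiff_of_exists_hasDerivAt hd fun l hl =>
    (DSmooth.comp (g := l) hl hc).contDiff

end WeaklySmooth

/-! ## Stability properties of convenient spaces -/

section Stability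

variable {V : Type u} [AddCommGroup V] [Module ℝ V] [DiffeologicalSpace V]
  {W : Type v} [AddCommGroup W] [Module ℝ W] [DiffeologicalSpace W]

theorem comp_mem_smoothDual {l : W →ₗ[ℝ] ℝ} (hl : l ∈ smoothDual W) {f : V →ₗ[ℝ] W}
    (hf : DSmooth f) : l.comp f ∈ smoothDual V := DSmooth.comp (g := l) hl hf

theorem dSmooth_fst {X : Type u} {Y : Type v} [DiffeologicalSpace X] [DiffeologicalSpace Y] :
    DSmooth (Prod.fst : X × Y → X) := fun _ _ hp => hp.1

theorem dSmooth_snd {X : Type u} {Y : Type v} [DiffeologicalSpace X] [DiffeologicalSpace Y] :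
    DSmooth (Prod.snd : X × Y → Y) := fun _ _ hp => hp.2

theorem dSmooth_eval {ι : Type v} {X : ι → Type u} [∀ i, DiffeologicalSpace (X i)] (i : ι) :
    DSmooth (fun x : ∀ i, X i => x i) := fun _ _ hp => hp i

/-- Functionals pulled back from the two factors already detect plots and separate points.
Differentiability must be tested on every functional, but each one is a sum of two pulled back from
the factors, by restriction along `inl` and `inr`. -/
theorem IsConvenient.prod (hV : IsConvenient V) (hW : IsConvenient W) : IsConvenient (V × W) := by
  have hfst : ∀ l ∈ smoothDual V, l.comp (LinearMap.fst ℝ V W) ∈ smoothDual (V × W) :=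
    fun l hl => comp_mem_smoothDual hl dSmooth_fst
  have hsnd : ∀ l ∈ smoothDual W, l.comp (LinearMap.snd ℝ V W) ∈ smoothDual (V × W) :=
    fun l hl => comp_mem_smoothDual hl dSmooth_snd
  refine IsConvenient.of
    ({l | ∃ m ∈ smoothDual V, l = m.comp (LinearMap.fst ℝ V W)} ∪
      {l | ∃ m ∈ smoothDual W, l = m.comp (LinearMap.snd ℝ V W)}) ?_ ?_ ?_ ?_
  · rintro _ (⟨l, hl, rfl⟩ | ⟨l, hl, rfl⟩)
    exacts [hfst l hl, hsnd l hl]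
  · intro n p h
    exact ⟨hV.isPlot_iff.2 fun l hl => h _ (Or.inl ⟨l, hl, rfl⟩),
      hW.isPlot_iff.2 fun l hl => h _ (Or.inr ⟨l, hl, rfl⟩)⟩
  · intro x y h
    exact Prod.ext (hV.ext fun l hl => h _ (Or.inl ⟨l, hl, rfl⟩))
      (hW.ext fun l hl => h _ (Or.inr ⟨l, hl, rfl⟩))
  · intro c hc
    obtain ⟨a, ha⟩ := hV.exists_hasDerivAt (c := fun s => (c s).1) (fun l hl => hc _ (hfst l hl)) 0
    obtain ⟨b, hb⟩ := hW.exists_hasDerivAt (c := fun s => (c s).2) (fun l hl => hc _ (hsnd l hl)) 0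
    refine ⟨(a, b), fun l hl => ?_⟩
    have h1 : l.comp (LinearMap.inl ℝ V W) ∈ smoothDual V :=
      comp_mem_smoothDual hl fun _ _ hp => ⟨hp, isPlot_const⟩
    have h2 : l.comp (LinearMap.inr ℝ V W) ∈ smoothDual W :=
      comp_mem_smoothDual hl fun _ _ hp => ⟨isPlot_const, hp⟩
    have h3 : ∀ z : V × W, l z = l.comp (LinearMap.inl ℝ V W) z.1 +
        l.comp (LinearMap.inr ℝ V W) z.2 := fun z => by
      simp [← map_add]
    simp only [h3]
    exact (ha _ h1).add (hb _ h2)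

/-- As for binary products; finiteness of `ι` makes every functional a finite sum of functionals of
single coordinates. -/
theorem IsConvenient.pi {ι : Type} [Fintype ι] (hV : IsConvenient V) :
    IsConvenient (ι → V) := by
  classical
  have hpr : ∀ (i : ι), ∀ l ∈ smoothDual V,
      l.comp (LinearMap.proj (R := ℝ) (φ := fun _ : ι => V) i) ∈ smoothDual (ι → V) :=
    fun i l hl => comp_mem_smoothDual hl (dSmooth_eval i)
  refine IsConvenient.of {l | ∃ i : ι, ∃ m ∈ smoothDual V,
    l = m.comp (LinearMap.proj (R := ℝ) (φ := fun _ : ι => V) i)} ?_ ?_ ?_ ?_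
  · rintro _ ⟨i, l, hl, rfl⟩
    exact hpr i l hl
  · intro n p h i
    exact hV.isPlot_iff.2 fun l hl => h _ ⟨i, l, hl, rfl⟩
  · intro x y h
    exact funext fun i => hV.ext fun l hl => h _ ⟨i, l, hl, rfl⟩
  · intro c hc
    have h0 := fun i => hV.exists_hasDerivAt (c := fun s => c s i) (fun l hl => hc _ (hpr i l hl)) 0
    choose w hw using h0
    refine ⟨w, fun l hl => ?_⟩
    have h1 : ∀ i, l.comp (LinearMap.single ℝ (fun _ : ι => V) i) ∈ smoothDual V := fun i =>
      comp_mem_smoothDual hl fun n p hp j => by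
        by_cases hj : j = i
        · subst hj
          simpa [Function.comp_def] using hp
        · simpa [Function.comp_def, Pi.single_eq_of_ne hj] using isPlot_const
    have h3 : ∀ z : ι → V, l z = ∑ i, l.comp (LinearMap.single ℝ (fun _ : ι => V) i) (z i) :=
      fun z => by
        conv_lhs => rw [← Finset.univ_sum_single z, map_sum]
        rfl
    simp only [h3]
    exact HasDerivAt.fun_sum fun i _ => hw i _ (h1 i)

theorem IsConvenient.of_linearEquiv (hW : IsConvenient W) (e : V ≃ₗ[ℝ] W)
    (he : ∀ (n : ℕ) (p : EuclideanSpace ℝ (Fin n) → V), IsPlot p ↔ IsPlot (e ∘ p)) :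
    IsConvenient V := by
  have h1 : ∀ l ∈ smoothDual W, l.comp e.toLinearMap ∈ smoothDual V := fun l hl =>
    comp_mem_smoothDual hl fun n p hp => (he n p).1 hp
  have h2 : ∀ l ∈ smoothDual V, l.comp e.symm.toLinearMap ∈ smoothDual W := fun l hl =>
    comp_mem_smoothDual hl fun n p hp => (he n _).2 (by simpa [Function.comp_def] using hp)
  refine IsConvenient.of (smoothDual V) le_rfl ?_ ?_ ?_
  · intro n p h
    exact (he n p).2 (hW.isPlot_iff.2 fun l hl => h _ (h1 l hl))
  · intro x y h
    exact e.injective (hW.ext fun l hl => h _ (h1 l hl))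
  · intro c hc
    obtain ⟨w, hw⟩ := hW.exists_hasDerivAt (c := fun s => e (c s)) (fun l hl => hc _ (h1 l hl)) 0
    refine ⟨e.symm w, fun l hl => ?_⟩
    simpa using hw _ (h2 l hl)

end Stability

/-! ## Weak derivatives of plots -/

/-- Through every point of an open set there is a globally defined smooth map with prescribed
derivative. -/
theorem Cart.exists_hasFDerivAt {U : Cart} (x : U) {E : Type} [NormedAddCommGroup E]
    [NormedSpace ℝ E] [FiniteDimensional ℝ E] (L : E →L[ℝ] EuclideanSpace ℝ (Fin U.dim)) :
    ∃ γ : E → EuclideanSpace ℝ (Fin U.dim), ContDiff ℝ ∞ γ ∧ (∀ s, γ s ∈ U.carrier) ∧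
      γ 0 = x ∧ HasFDerivAt γ L 0 := by
  obtain ⟨ε, hε, hb⟩ := Metric.isOpen_iff.mp U.isOpen x x.2
  have hpos : 0 < ε / (‖L‖ + 1) := by positivity
  -- On the support of the bump `‖L s‖ < ε`, so `x + b(s) L s` stays in the ball inside `U`. Near
  -- `0` the bump is `1`, so the derivative there is `L`. The `+ 1` covers `L = 0`.
  let b : ContDiffBump (0 : E) := ⟨ε / (‖L‖ + 1) / 2, ε / (‖L‖ + 1), by positivity, by linarith⟩
  refine ⟨fun s => x + b s • L s, contDiff_const.add (b.contDiff.smul L.contDiff), fun s => hb ?_,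
    by simp, ?_⟩
  · rw [mem_ball_iff_norm, add_sub_cancel_left, norm_smul]
    by_cases hs : s ∈ Metric.ball (0 : E) (ε / (‖L‖ + 1))
    · have h1 : ‖s‖ < ε / (‖L‖ + 1) := by simpa using hs
      have h2 : ‖b s‖ ≤ 1 := by
        rw [Real.norm_of_nonneg b.nonneg]
        exact b.le_one
      calc ‖b s‖ * ‖L s‖ ≤ 1 * (‖L‖ * ‖s‖) := by
            gcongr
            exact L.le_opNorm s
        _ ≤ (‖L‖ + 1) * ‖s‖ := by nlinarith [norm_nonneg s]
        _ < (‖L‖ + 1) * (ε / (‖L‖ + 1)) := by gcongr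
        _ = ε := by field_simp
    · rw [b.zero_of_le_dist (by simpa using hs)]
      simpa using hε
  · have h1 : HasFDerivAt (fun s => x.1 + L s) L 0 := L.hasFDerivAt.const_add x.1
    refine h1.congr_of_eventuallyEq ?_
    filter_upwards [b.eventuallyEq_one] with s hs
    simp only [hs, Pi.one_apply, one_smul]

open Classical in
/-- Extension by zero of a vector-valued map on `U`. -/
def Cart.extendZero {V : Type u} [Zero V] {U : Cart} (p : U → V) : EuclideanSpace ℝ (Fin U.dim) → V :=
  fun x => if h : x ∈ U.carrier then p ⟨x, h⟩ else 0

theorem Cart.extendZero_apply {V : Type u} [Zero V] {U : Cart} (p : U → V) (x : U) :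
    Cart.extendZero p x = p x := dif_pos x.2

section Velocity

variable {V : Type u} [AddCommGroup V] [Module ℝ V] [DiffeologicalSpace V]

theorem Cart.contDiffOn_extendZero {U : Cart} (p : SMap U V) {l : V →ₗ[ℝ] ℝ}
    (hl : l ∈ smoothDual V) : ContDiffOn ℝ ∞ (fun x => l (Cart.extendZero p x)) U.carrier := by
  -- `Cart.contDiffOn_extend` concerns maps into Euclidean spaces, so the real-valued function is
  -- viewed as a map into `ℝ¹`.
  let f : U → EuclideanSpace ℝ (Fin 1) := fun x => WithLp.toLp 2 fun _ => l (p x)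
  have hf : DSmooth f := fun n q hq => by
    have h1 : ContDiff ℝ ∞ fun t => l (p (q t)) := hl n _ (p.smooth n q hq)
    change ContDiff ℝ ∞ (f ∘ q)
    exact contDiff_euclidean.2 fun _ => h1
  have h2 := contDiffOn_euclidean.1 (Cart.contDiffOn_extend hf) 0
  refine h2.congr fun x hx => ?_
  have e1 := Cart.extend_apply f ⟨x, hx⟩
  have e2 := Cart.extendZero_apply p ⟨x, hx⟩
  simp only at e1 e2
  rw [e1, e2]

theorem Cart.contDiffAt_extendZero {U : Cart} (p : SMap U V) {l : V →ₗ[ℝ] ℝ}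
    (hl : l ∈ smoothDual V) (x : U) : ContDiffAt ℝ ∞ (fun x => l (Cart.extendZero p x)) x :=
  (Cart.contDiffOn_extendZero p hl).contDiffAt (U.isOpen.mem_nhds x.2)

/-- The derivative of `l ∘ p` along a tangent vector. -/
def dualDeriv {U : Cart} (p : SMap U V) (l : V →ₗ[ℝ] ℝ) (x : tanObj U) : ℝ :=
  fderiv ℝ (fun y => l (Cart.extendZero p y)) (tanBase x) (tanVec x)

theorem dualDeriv_eq {U : Cart} {p : SMap U V} {l : V →ₗ[ℝ] ℝ} {x : tanObj U}
    {f : EuclideanSpace ℝ (Fin U.dim) → ℝ} {f' : EuclideanSpace ℝ (Fin U.dim) →L[ℝ] ℝ}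
    (h : ∀ y : U, l (p y) = f y) (hf : HasFDerivAt f f' (tanBase x).1) :
    dualDeriv p l x = f' (tanVec x) := by
  have h1 : HasFDerivAt (fun y => l (Cart.extendZero p y)) f' (tanBase x).1 := by
    refine hf.congr_of_eventuallyEq ?_
    filter_upwards [U.isOpen.mem_nhds (tanBase x).2] with y hy
    rw [← h ⟨y, hy⟩, ← Cart.extendZero_apply p ⟨y, hy⟩]
  rw [dualDeriv, h1.fderiv]

/-- The chain rule for `l ∘ p ∘ f`; it is what makes weak derivatives compatible with the relation
defining the colimit. -/
theorem dualDeriv_comp {U U' : Cart} (p : SMap U' V) (f : SMap U U') {l : V →ₗ[ℝ] ℝ}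
    (hl : l ∈ smoothDual V) (x : tanObj U) :
    dualDeriv (p.comp f) l x = dualDeriv p l (tanMap f x) := by
  have h1 : HasFDerivAt (fun y => l (Cart.extendZero p y))
      (fderiv ℝ (fun y => l (Cart.extendZero p y)) (f (tanBase x)).1)
      (Cart.extend (fun y => (f y).1) (tanBase x).1) := by
    rw [Cart.extend_apply]
    exact ((Cart.contDiffAt_extendZero p hl _).differentiableAt (by simp)).hasFDerivAt
  rw [dualDeriv_eq (f' := _) (f := _) ?_ (h1.comp _ (Cart.hasFDerivAt f (tanBase x)))]
  · simp only [dualDeriv, tanMap_apply, tanBase_mk, tanVec_mk]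
    rfl
  · intro y
    simp only [Function.comp]
    rw [Cart.extend_apply, Cart.extendZero_apply]
    rfl

theorem contDiff_dualDeriv {U : Cart} (p : SMap U V) {l : V →ₗ[ℝ] ℝ} (hl : l ∈ smoothDual V)
    {n : ℕ} {a : EuclideanSpace ℝ (Fin n) → tanObj U} (ha : IsPlot a) :
    ContDiff ℝ ∞ fun t => dualDeriv p l (a t) := by
  have h1 := (Cart.contDiffOn_extendZero p hl).fderiv_of_isOpen (m := ∞) U.isOpen (by simp)
  have hb : ContDiff ℝ ∞ (fun t => (tanBase (a t)).1) := dSmooth_tanBase U _ _ ha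
  have hv : ContDiff ℝ ∞ (fun t => tanVec (a t)) := dSmooth_tanVec U _ _ ha
  exact (h1.comp_contDiff hb fun t => (tanBase (a t)).2).clm_apply hv

/-- Convenience only supplies derivatives of curves, so `p` is restricted to a curve `γ` through the
footprint of `x` with velocity its vector part. Since `γ` never leaves `U`, the value of the
extension outside `U` plays no role. -/
theorem IsConvenient.exists_velocity (hV : IsConvenient V) {U : Cart} (p : SMap U V)
    (x : tanObj U) : ∃ w : V, ∀ l ∈ smoothDual V, l w = dualDeriv p l x := by
  obtain ⟨γ, hγ, hU, h0, hd⟩ := Cart.exists_hasFDerivAt (tanBase x)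
    (ContinuousLinearMap.toSpanSingleton ℝ (tanVec x))
  have hc : ∀ l ∈ smoothDual V, ContDiff ℝ ∞ fun s => l (Cart.extendZero p (γ s)) :=
    fun l hl => (Cart.contDiffOn_extendZero p hl).comp_contDiff hγ hU
  obtain ⟨w, hw⟩ := hV.exists_hasDerivAt (c := fun s => Cart.extendZero p (γ s)) hc 0
  refine ⟨w, fun l hl => (hw l hl).unique ?_⟩
  have h1 : HasFDerivAt (fun y => l (Cart.extendZero p y))
      (fderiv ℝ (fun y => l (Cart.extendZero p y)) (tanBase x).1) (γ 0) := by
    rw [h0]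
    exact ((Cart.contDiffAt_extendZero p hl _).differentiableAt (by simp)).hasFDerivAt
  simpa [dualDeriv, Function.comp_def] using (h1.comp (0 : ℝ) hd).hasDerivAt

/-- The weak derivative of a plot along a tangent vector. -/
def IsConvenient.velocity (hV : IsConvenient V) {U : Cart} (p : SMap U V) (x : tanObj U) : V :=
  (hV.exists_velocity p x).choose

theorem IsConvenient.dual_velocity (hV : IsConvenient V) {U : Cart} (p : SMap U V) (x : tanObj U)
    {l : V →ₗ[ℝ] ℝ} (hl : l ∈ smoothDual V) : l (hV.velocity p x) = dualDeriv p l x :=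
  (hV.exists_velocity p x).choose_spec l hl

theorem IsConvenient.velocity_comp (hV : IsConvenient V) {U U' : Cart} (p : SMap U' V)
    (f : SMap U U') (x : tanObj U) :
    hV.velocity (p.comp f) x = hV.velocity p (tanMap f x) :=
  hV.ext fun l hl => by rw [hV.dual_velocity _ _ hl, hV.dual_velocity _ _ hl, dualDeriv_comp _ _ hl]

theorem IsConvenient.dSmooth_velocity (hV : IsConvenient V) {U : Cart} (p : SMap U V) :
    DSmooth (hV.velocity p) := fun n a ha => hV.isPlot_iff.2 fun l hl => by
  simpa only [Function.comp, hV.dual_velocity p _ hl] using contDiff_dualDeriv p hl ha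

/-- `TV → V × V`, `p_*(u, v) ↦ (p(u), D_u p(v))`. -/
def IsConvenient.tanCoord (hV : IsConvenient V) : SMap (Tan V) (V × V) where
  toFun := Quot.lift (fun z => (z.2.1 (tanBase z.2.2), hV.velocity z.2.1 z.2.2)) (by
    rintro _ _ ⟨f, p', x⟩
    exact Prod.ext (congrArg p' (tanBase_mk (f (tanBase x)) _).symm) (hV.velocity_comp p' f x))
  smooth := Kan.dSmooth_of fun U p n a ha =>
    ⟨p.smooth _ _ (dSmooth_tanBase U _ _ ha), hV.dSmooth_velocity p n a ha⟩

theorem IsConvenient.tanCoord_fst (hV : IsConvenient V) (z : Tan V) :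
    (hV.tanCoord z).1 = footprint V z := by
  induction z using Kan.ind with
  | h U p x => rfl

end Velocity

/-! ## Hadamard's lemma in convenient spaces -/

section Hadamard

variable {V : Type u} [AddCommGroup V] [Module ℝ V] [DiffeologicalSpace V]

/-- Take the difference quotient for `t ≠ 0` and the weak derivative at `t = 0`. After applying a
functional this is the classical quotient of `exists_contDiff_slope`, hence smooth, although no
integral in `V` is available. -/
theorem IsConvenient.exists_slope (hV : IsConvenient V) {E : Type} [NormedAddCommGroup E]
    [NormedSpace ℝ E] [FiniteDimensional ℝ E] {f : E × ℝ → V} (hf : WeaklySmooth f) :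
    ∃ g : E × ℝ → V, WeaklySmooth g ∧ ∀ x t, f (x, t) = f (x, 0) + t • g (x, t) := by
  have h0 : ∀ x : E, ∃ w : V, ∀ l ∈ smoothDual V, HasDerivAt (fun s => l (f (x, s))) (l w) 0 :=
    fun x => hV.exists_hasDerivAt (c := fun s => f (x, s)) (hf.comp (by fun_prop)) 0
  choose w hw using h0
  classical
  refine ⟨fun z => if z.2 = 0 then w z.1 else z.2⁻¹ • (f z - f (z.1, 0)), fun l hl => ?_,
    fun x t => ?_⟩
  · obtain ⟨g, hg, h1, h2⟩ := exists_contDiff_slope (hf l hl)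
    convert hg using 1
    funext ⟨x, t⟩
    by_cases ht : t = 0
    · subst ht
      simp only [if_true, h2]
      refine (hw x l hl).unique ?_
      have h3 : HasDerivAt (fun s : ℝ => ((x, s) : E × ℝ)) (0, 1) 0 :=
        (hasDerivAt_const _ _).prodMk (hasDerivAt_id _)
      exact (((hf l hl).differentiable (by simp)) (x, 0)).hasFDerivAt.comp_hasDerivAt 0 h3
    · simp only [ht, if_false, map_smul, map_sub, smul_eq_mul, h1 x t]
      field_simp
      ring
  · by_cases ht : t = 0
    · subst ht
      simp
    · simp [ht, smul_smul]

/-- Moving from `0` to `s` one coordinate at a time writes `f s - f 0` as a telescoping sum, each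
step of which is handled by the one-variable slope. -/
theorem IsConvenient.exists_hadamard (hV : IsConvenient V) {k : ℕ} {f : (Fin k → ℝ) → V}
    (hf : WeaklySmooth f) : ∃ g : Fin k → (Fin k → ℝ) → V, (∀ i, WeaklySmooth (g i)) ∧
      ∀ s, f s = f 0 + ∑ i, s i • g i s := by
  -- `P j s` keeps the first `j` coordinates of `s` and kills the others, so `P 0 s = 0` and `P k s
  -- = s`.
  let P : ℕ → (Fin k → ℝ) → Fin k → ℝ := fun j s i => if i.1 < j then s i else 0
  have hP : ∀ j, ContDiff ℝ ∞ (P j) := fun j => contDiff_pi.2 fun i => by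
    by_cases h : i.1 < j
    · simpa only [P, h, if_true] using contDiff_apply ℝ ℝ i
    · simpa only [P, h, if_false] using contDiff_const
  have hF : ∀ i : Fin k, WeaklySmooth fun z : (Fin k → ℝ) × ℝ =>
      f (P i z.1 + z.2 • Pi.single i 1) := fun i =>
    hf.comp (((hP i).comp contDiff_fst).add (contDiff_snd.smul contDiff_const))
  choose g hg h using fun i => hV.exists_slope (hF i)
  refine ⟨fun i s => g i (s, s i), fun i => (hg i).comp
    (contDiff_id.prodMk (contDiff_apply ℝ ℝ i)), fun s => ?_⟩
  have hstep : ∀ i : Fin k, s i • g i (s, s i) = f (P (i.1 + 1) s) - f (P i.1 s) := fun i => by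
    have h1 := h i s (s i)
    have h2 : P i.1 s + s i • Pi.single i 1 = P (i.1 + 1) s := by
      funext j
      rcases lt_trichotomy j.1 i.1 with hj | hj | hj
      · have : j ≠ i := fun e => by simp [e] at hj
        simp only [P, Pi.add_apply, Pi.smul_apply, Pi.single_eq_of_ne this, hj,
          Nat.lt_succ_of_lt hj, if_true, smul_zero, add_zero]
      · obtain rfl : j = i := Fin.ext hj
        simp [P]
      · have : j ≠ i := fun e => by simp [e] at hj
        simp only [P, Pi.add_apply, Pi.smul_apply, Pi.single_eq_of_ne this, hj.not_gt,
          (Nat.succ_le_of_lt hj).not_gt, if_false, smul_zero, add_zero]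
    simp only [h2, zero_smul, add_zero] at h1
    rw [h1, add_sub_cancel_left]
  have h0 : P 0 s = 0 := by
    funext i
    simp [P]
  have hk : P k s = s := by
    funext i
    simp [P]
  rw [Finset.sum_congr rfl fun i _ => hstep i,
    Fin.sum_univ_eq_sum_range (fun j => f (P (j + 1) s) - f (P j s)) k,
    Finset.sum_range_sub fun j => f (P j s), h0, hk, add_sub_cancel]

end Hadamard

/-! ## Finite-dimensional normed spaces as objects of `Cart` -/

section FullCart

/-- A finite-dimensional normed space as an object of `Cart`. -/
def fullCart (E : Type) [NormedAddCommGroup E] [NormedSpace ℝ E] [FiniteDimensional ℝ E] : Cart where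
  dim := Module.finrank ℝ E
  carrier := Set.univ
  isOpen := isOpen_univ

variable {E E' : Type} [NormedAddCommGroup E] [NormedSpace ℝ E] [FiniteDimensional ℝ E]
  [NormedAddCommGroup E'] [NormedSpace ℝ E'] [FiniteDimensional ℝ E']

/-- The linear coordinates of `fullCart E`. -/
def fullCart.coord (E : Type) [NormedAddCommGroup E] [NormedSpace ℝ E] [FiniteDimensional ℝ E] :
    E ≃L[ℝ] EuclideanSpace ℝ (Fin (fullCart E).dim) := toEuclidean

/-- The point of `fullCart E` given by an element of `E`. -/
def fullCart.pt (a : E) : fullCart E := ⟨fullCart.coord E a, Set.mem_univ _⟩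

/-- The tangent vector of `fullCart E` given by elements of `E`. -/
def fullCart.vec (a v : E) : tanObj (fullCart E) := tanMk (fullCart.pt a) (fullCart.coord E v)

/-- Smooth maps as morphisms of `Cart`. -/
def fullCart.map {U : Cart} (f : E → EuclideanSpace ℝ (Fin U.dim)) (hf : ContDiff ℝ ∞ f)
    (hU : ∀ x, f x ∈ U.carrier) : SMap (fullCart E) U where
  toFun x := ⟨f ((fullCart.coord E).symm x.1), hU _⟩
  smooth _ _ hp := hf.comp ((fullCart.coord E).symm.contDiff.comp (n := ∞) hp)

/-- Reduces tangent maps to ordinary Fréchet derivatives, so that product spaces can be used as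
parameter domains without writing coordinates. -/
theorem fullCart.tanMap_map {U : Cart} {f : E → EuclideanSpace ℝ (Fin U.dim)}
    (hf : ContDiff ℝ ∞ f) (hU : ∀ x, f x ∈ U.carrier) {a : E}
    {f' : E →L[ℝ] EuclideanSpace ℝ (Fin U.dim)} (h : HasFDerivAt f f' a) (v : E) :
    tanMap (fullCart.map f hf hU) (fullCart.vec a v) = tanMk ⟨f a, hU a⟩ (f' v) := by
  have h1 : (fullCart.map f hf hU) (fullCart.pt a) = ⟨f a, hU a⟩ :=
    Subtype.ext (congrArg f ((fullCart.coord E).symm_apply_apply a))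
  have h2 : HasFDerivAt (Cart.extend fun y => (fullCart.map f hf hU y).1)
      (f'.comp ((fullCart.coord E).symm : _ →L[ℝ] E)) (fullCart.pt a).1 := by
    have h3 : HasFDerivAt f f' ((fullCart.coord E).symm (fullCart.pt a).1) := by
      simpa [fullCart.pt] using h
    refine (h3.comp _ (fullCart.coord E).symm.hasFDerivAt).congr_of_eventuallyEq
      (Filter.Eventually.of_forall fun y => ?_)
    exact Cart.extend_apply (U := fullCart E) (fun y => (fullCart.map f hf hU y).1) ⟨y, trivial⟩
  have h4 : Cart.deriv (fullCart.map f hf hU) (fullCart.pt a) = _ :=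
    (Cart.hasFDerivAt _ _).unique h2
  rw [tanMap_apply, fullCart.vec, tanBase_mk, tanVec_mk, h4, h1]
  simp

/-- Smooth maps between finite-dimensional spaces as morphisms of `Cart`. -/
def fullCart.hom (f : E → E') (hf : ContDiff ℝ ∞ f) : SMap (fullCart E) (fullCart E') :=
  fullCart.map (fun x => fullCart.coord E' (f x)) ((fullCart.coord E').contDiff.comp hf)
    fun _ => Set.mem_univ _

theorem fullCart.hom_pt {f : E → E'} (hf : ContDiff ℝ ∞ f) (a : E) :
    fullCart.hom f hf (fullCart.pt a) = fullCart.pt (f a) :=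
  Subtype.ext (congrArg (fun x => fullCart.coord E' (f x))
    ((fullCart.coord E).symm_apply_apply a))

theorem fullCart.tanMap_hom {f : E → E'} (hf : ContDiff ℝ ∞ f) {a : E} {f' : E →L[ℝ] E'}
    (h : HasFDerivAt f f' a) (v : E) :
    tanMap (fullCart.hom f hf) (fullCart.vec a v) = fullCart.vec (f a) (f' v) :=
  fullCart.tanMap_map _ _ ((fullCart.coord E').hasFDerivAt.comp a h) v

variable {V : Type u} [AddCommGroup V] [Module ℝ V] [DiffeologicalSpace V]

/-- Weakly smooth maps as plots. -/
def IsConvenient.plot (hV : IsConvenient V) (q : E → V) (hq : WeaklySmooth q) :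
    SMap (fullCart E) V where
  toFun x := q ((fullCart.coord E).symm x.1)
  smooth _ _ hp := hV.isPlot_iff.2 (hq.comp ((fullCart.coord E).symm.contDiff.comp (n := ∞) hp))

theorem IsConvenient.plot_pt (hV : IsConvenient V) {q : E → V} (hq : WeaklySmooth q) (a : E) :
    hV.plot q hq (fullCart.pt a) = q a :=
  congrArg q ((fullCart.coord E).symm_apply_apply a)

/-- Turns an identity between functions into a factorisation of plots, the form needed to apply
`Kan.mk_comp`. -/
theorem IsConvenient.plot_comp_hom (hV : IsConvenient V) {q : E' → V} (hq : WeaklySmooth q)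
    {f : E → E'} (hf : ContDiff ℝ ∞ f) {r : E → V} (hr : WeaklySmooth r) (h : ∀ x, q (f x) = r x) :
    (hV.plot q hq).comp (fullCart.hom f hf) = hV.plot r hr :=
  SMap.ext fun x => by
    refine Eq.trans (congrArg q ?_) (h ((fullCart.coord E).symm x.1))
    exact (fullCart.coord E').symm_apply_apply _

theorem IsConvenient.dualDeriv_plot (hV : IsConvenient V) {q : E → V} (hq : WeaklySmooth q)
    {l : V →ₗ[ℝ] ℝ} {a : E} {q' : E →L[ℝ] ℝ} (h : HasFDerivAt (fun x => l (q x)) q' a) (v : E) :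
    dualDeriv (hV.plot q hq) l (fullCart.vec a v) = q' v := by
  have h1 : HasFDerivAt (fun x => l (q x)) q'
      ((fullCart.coord E).symm (tanBase (fullCart.vec a v)).1) := by
    rw [fullCart.vec, tanBase_mk]
    simpa [fullCart.pt] using h
  rw [dualDeriv_eq (f := fun x => l (q ((fullCart.coord E).symm x))) (fun _ => rfl)
    (h1.comp _ (fullCart.coord E).symm.hasFDerivAt), fullCart.vec, tanVec_mk]
  simp

theorem weaklySmooth_comp_pt (r : SMap (fullCart E) V) :
    WeaklySmooth fun x => r (fullCart.pt x) := fun l hl => by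
  have h1 : IsPlot fun y : EuclideanSpace ℝ (Fin (fullCart E).dim) =>
      (⟨y, Set.mem_univ _⟩ : fullCart E) := (contDiff_id (n := ∞) : ContDiff ℝ ∞ _)
  have h2 : ContDiff ℝ ∞ fun y : EuclideanSpace ℝ (Fin (fullCart E).dim) =>
      l (r ⟨y, Set.mem_univ _⟩) := hl _ _ (r.smooth _ _ h1)
  exact h2.comp (fullCart.coord E).contDiff

theorem IsConvenient.plot_comp_pt (hV : IsConvenient V) (r : SMap (fullCart E) V) :
    hV.plot _ (weaklySmooth_comp_pt r) = r :=
  SMap.ext fun x => congrArg r (Subtype.ext ((fullCart.coord E).apply_symm_apply x.1))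

end FullCart

/-! ## Affine plots represent all tangent vectors -/

section Affine

variable {V : Type u} [AddCommGroup V] [Module ℝ V] [DiffeologicalSpace V]

theorem weaklySmooth_affine {k : ℕ} (x : V) (w : Fin k → V) :
    WeaklySmooth fun s : Fin k → ℝ => x + ∑ i, s i • w i :=
  (WeaklySmooth.const x).add (WeaklySmooth.sum fun i _ =>
    WeaklySmooth.smul (contDiff_apply ℝ ℝ i) (WeaklySmooth.const (w i)))

/-- The affine plot `s ↦ x + ∑ sᵢ wᵢ`. -/
def IsConvenient.affine (hV : IsConvenient V) {k : ℕ} (x : V) (w : Fin k → V) :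
    SMap (fullCart (Fin k → ℝ)) V := hV.plot _ (weaklySmooth_affine x w)

theorem IsConvenient.velocity_affine (hV : IsConvenient V) {k : ℕ} (x : V) (w : Fin k → V)
    (i : Fin k) : hV.velocity (hV.affine x w) (fullCart.vec 0 (Pi.single i 1)) = w i := by
  refine hV.ext fun l hl => ?_
  have h1 : HasFDerivAt (fun s : Fin k → ℝ => l (x + ∑ i, s i • w i))
      (∑ i, l (w i) • (ContinuousLinearMap.proj i : (Fin k → ℝ) →L[ℝ] ℝ)) 0 := by
    refine ((∑ i, l (w i) • (ContinuousLinearMap.proj i :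
      (Fin k → ℝ) →L[ℝ] ℝ)).hasFDerivAt.const_add (l x)).congr_of_eventuallyEq
        (Filter.Eventually.of_forall fun s => ?_)
    simp [mul_comm]
  rw [hV.dual_velocity _ _ hl, IsConvenient.affine, hV.dualDeriv_plot _ h1]
  simp [Pi.single_apply]

/-- The standard frame of `ℝᵏ` at the origin. -/
def stdFrame (k : ℕ) : FiberPow (tanBase (U := fullCart (Fin k → ℝ))) k :=
  ⟨(fullCart.pt 0, fun i => fullCart.vec 0 (Pi.single i 1)), fun _ => tanBase_mk _ _⟩

/-- Choose `γ` with `γ(0)` the base point and differential at `0` sending the `i`-th basis vector to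
the `i`-th given vector. In the colimit it thus suffices to treat plots on `ℝᵏ` with the standard
frame. -/
theorem exists_map_stdFrame {U : Cart} {k : ℕ} (z : FiberPow (tanBase (U := U)) k) :
    ∃ γ : SMap (fullCart (Fin k → ℝ)) U, tanPowMap γ k (stdFrame k) = z := by
  obtain ⟨γ, hγ, hU, h0, hd⟩ := Cart.exists_hasFDerivAt z.1.1
    (∑ i, (ContinuousLinearMap.proj i : (Fin k → ℝ) →L[ℝ] ℝ).smulRight (tanVec (z.1.2 i)))
  refine ⟨fullCart.map γ hγ hU, ?_⟩
  have h1 : (⟨γ 0, hU 0⟩ : U) = z.1.1 := Subtype.ext h0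
  refine Subtype.ext (Prod.ext ?_ (funext fun i => ?_))
  · exact (Subtype.ext (congrArg γ ((fullCart.coord (Fin k → ℝ)).symm_apply_apply 0))).trans h1
  · refine (fullCart.tanMap_map hγ hU hd (Pi.single i 1)).trans ?_
    rw [h1, ← z.2 i]
    refine Eq.trans (congrArg (tanMk (tanBase (z.1.2 i))) ?_) (tanMk_base_vec (z.1.2 i))
    simp [Pi.single_apply]

/-- The tangent vectors represented by affine plots. -/
def IsConvenient.affTan (hV : IsConvenient V) (k : ℕ) (z : V × (Fin k → V)) :
    Kan (tanHatPow k) V := Kan.mk (F := tanHatPow k) (hV.affine z.1 z.2) (stdFrame k)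

/-- A class depends only on the first-order part of the plot. The second-order remainder is removed
by treating its quadratic coefficients as extra parameters. -/
theorem IsConvenient.affTan_surjective (hV : IsConvenient V) (k : ℕ) :
    Function.Surjective (hV.affTan k) := by
  intro z
  induction z using Kan.ind with
  | h U p z =>
    obtain ⟨γ, rfl⟩ := exists_map_stdFrame z
    have hc := weaklySmooth_comp_pt (p.comp γ)
    obtain ⟨g, hg, h1⟩ := hV.exists_hadamard hc
    -- Expanding the coefficients once more makes the remainder quadratic in `s`, with coefficients
    -- `h i j` that are still plots.
    choose h hh h2 using fun i => hV.exists_hadamard (hg i)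
    set x := p (γ (fullCart.pt 0))
    -- The products `sᵢ sⱼ` become independent variables: setting them to `sᵢ sⱼ` recovers the plot,
    -- setting them to `0` its affine part.
    let Q : (Fin k → ℝ) × (Fin k → Fin k → ℝ) → V := fun y =>
      x + ∑ i, y.1 i • g i 0 + ∑ i, ∑ j, y.2 i j • h i j y.1
    have hQ : WeaklySmooth Q := by
      refine ((weaklySmooth_affine x fun i => g i 0).comp contDiff_fst).add
        (WeaklySmooth.sum fun i _ => WeaklySmooth.sum fun j _ => WeaklySmooth.smul ?_
          ((hh i j).comp contDiff_fst))
      fun_prop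
    let f : (Fin k → ℝ) → (Fin k → ℝ) × (Fin k → Fin k → ℝ) := fun s => (s, fun i j => s i * s j)
    have hf : ContDiff ℝ ∞ f := by fun_prop
    have hg' : ContDiff ℝ ∞ fun s : Fin k → ℝ => ((s, 0) : (Fin k → ℝ) × (Fin k → Fin k → ℝ)) := by
      fun_prop
    have hpf : p.comp γ = (hV.plot Q hQ).comp (fullCart.hom f hf) := by
      rw [← hV.plot_comp_pt (p.comp γ)]
      refine (hV.plot_comp_hom _ _ _ fun s => ?_).symm
      rw [h1 s]
      simp only [Q, f, mul_smul, add_assoc, ← Finset.smul_sum, ← Finset.sum_add_distrib,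
        ← smul_add, ← h2]
      rfl
    have hpg : hV.affine x (fun i => g i 0) = (hV.plot Q hQ).comp (fullCart.hom _ hg') :=
      (hV.plot_comp_hom _ _ _ fun s => by simp [Q]).symm
    -- The quadratic components have zero derivative at `0`, so `f` and `s ↦ (s, 0)` send the
    -- standard frame to the same frame.
    have hfd : HasFDerivAt f (ContinuousLinearMap.inl ℝ _ _) 0 := by
      refine (hasFDerivAt_id _).prodMk (hasFDerivAt_pi'' fun i => hasFDerivAt_pi'' fun j => ?_)
      have h3 : ∀ i : Fin k, HasFDerivAt (fun s : Fin k → ℝ => s i)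
          (ContinuousLinearMap.proj i : (Fin k → ℝ) →L[ℝ] ℝ) 0 := fun i =>
        (ContinuousLinearMap.proj i : (Fin k → ℝ) →L[ℝ] ℝ).hasFDerivAt
      exact ((h3 i).mul (h3 j)).congr_fderiv (by ext; simp)
    have hgd : HasFDerivAt (fun s : Fin k → ℝ => ((s, 0) : (Fin k → ℝ) × (Fin k → Fin k → ℝ)))
        (ContinuousLinearMap.inl ℝ _ _) 0 := hasFDerivAt_prodMk_left 0 0
    have h0 : f 0 = (0, 0) := Prod.ext rfl (funext fun i => funext fun j => mul_zero _)
    have key : tanPowMap (fullCart.hom f hf) k (stdFrame k) =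
        tanPowMap (fullCart.hom _ hg') k (stdFrame k) := by
      refine Subtype.ext (Prod.ext ?_ (funext fun i => ?_))
      · exact (fullCart.hom_pt hf 0).trans ((congrArg _ h0).trans (fullCart.hom_pt hg' 0).symm)
      · refine (fullCart.tanMap_hom hf hfd _).trans (Eq.trans ?_ (fullCart.tanMap_hom hg' hgd _).symm)
        rw [h0]
    refine ⟨(x, fun i => g i 0), ?_⟩
    calc hV.affTan k (x, fun i => g i 0)
        = Kan.mk (F := tanHatPow k) ((hV.plot Q hQ).comp (fullCart.hom _ hg')) (stdFrame k) := by
          rw [← hpg]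
          rfl
      _ = Kan.mk (F := tanHatPow k) (hV.plot Q hQ) (tanPowMap (fullCart.hom _ hg') k (stdFrame k)) :=
          Kan.mk_comp (F := tanHatPow k) _ _ _
      _ = Kan.mk (F := tanHatPow k) (hV.plot Q hQ) (tanPowMap (fullCart.hom f hf) k (stdFrame k)) := by
          rw [key]
      _ = Kan.mk (F := tanHatPow k) (p.comp γ) (stdFrame k) := by
          rw [hpf]
          exact (Kan.mk_comp (F := tanHatPow k) _ _ _).symm
      _ = Kan.mk (F := tanHatPow k) p (tanPowMap γ k (stdFrame k)) :=
          Kan.mk_comp (F := tanHatPow k) _ _ _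

/-- The affine plots belonging to the parameters `t` are the slices `s ↦ R(t, s)` of a single plot
`R`. Hence the family of classes lies in one component of the colimit, where only the frame at `(t,
0)` varies, smoothly in `t`. -/
theorem IsConvenient.dSmooth_affTan (hV : IsConvenient V) (k : ℕ) : DSmooth (hV.affTan k) := by
  intro n a ha
  let R : EuclideanSpace ℝ (Fin n) × (Fin k → ℝ) → V := fun y =>
    (a y.1).1 + ∑ i, y.2 i • (a y.1).2 i
  have hR : WeaklySmooth R :=
    ((hV.isPlot_iff.1 ha.1).comp contDiff_fst).add (WeaklySmooth.sum fun i _ =>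
      WeaklySmooth.smul ((contDiff_apply ℝ ℝ i).comp contDiff_snd)
        ((hV.isPlot_iff.1 (ha.2 i)).comp contDiff_fst))
  have hι : ∀ t : EuclideanSpace ℝ (Fin n), ContDiff ℝ ∞ fun s : Fin k → ℝ => (t, s) := fun t => by
    fun_prop
  have h1 : hV.affTan k ∘ a = fun t => Kan.mk (F := tanHatPow k) (hV.plot R hR)
      (tanPowMap (fullCart.hom _ (hι t)) k (stdFrame k)) := funext fun t => by
    refine Eq.trans ?_ (Kan.mk_comp (F := tanHatPow k) _ _ _)
    rw [hV.plot_comp_hom hR (hι t) (weaklySmooth_affine (a t).1 (a t).2) fun s => rfl]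
    rfl
  rw [h1]
  refine Kan.dSmooth_mk (F := tanHatPow k) (hV.plot R hR) n _ ?_
  have hpt : IsPlot fun t : EuclideanSpace ℝ (Fin n) =>
      fullCart.pt ((t, 0) : EuclideanSpace ℝ (Fin n) × (Fin k → ℝ)) := by
    have h2 : ContDiff ℝ ∞ fun t : EuclideanSpace ℝ (Fin n) =>
        ((t, 0) : EuclideanSpace ℝ (Fin n) × (Fin k → ℝ)) := by fun_prop
    exact (fullCart.coord (EuclideanSpace ℝ (Fin n) × (Fin k → ℝ))).contDiff.comp (n := ∞) h2
  refine ⟨?_, fun i => ?_⟩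
  · refine (congrArg IsPlot (funext fun t => ?_)).mp hpt
    exact (fullCart.hom_pt (hι t) 0).symm
  · refine (congrArg IsPlot (funext fun t => ?_)).mp
      (isPlot_tanMk hpt (isPlot_const (x := fullCart.coord (EuclideanSpace ℝ (Fin n) × (Fin k → ℝ))
        (0, Pi.single i 1))))
    exact (fullCart.tanMap_hom (hι t) (hasFDerivAt_prodMk_right t 0) (Pi.single i 1)).symm

end Affine

/-! ## The tangent bundle of a convenient space -/

section TangentBundle

theorem Tan.map_comp {X : Type u} {Y : Type v} {Z : Type w} [DiffeologicalSpace X]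
    [DiffeologicalSpace Y] [DiffeologicalSpace Z] (g : SMap Y Z) (f : SMap X Y) (z : Tan X) :
    Tan.map (g.comp f) z = Tan.map g (Tan.map f z) := by
  induction z using Kan.ind with
  | h => rfl

theorem Tan.map_id {X : Type u} [DiffeologicalSpace X] (z : Tan X) : Tan.map (SMap.id X) z = z := by
  induction z using Kan.ind with
  | h => rfl

theorem Tan.map_leftInverse {X : Type u} {Y : Type v} [DiffeologicalSpace X]
    [DiffeologicalSpace Y] {f : SMap X Y} {g : SMap Y X} (h : Function.LeftInverse g f) :
    Function.LeftInverse (Tan.map g) (Tan.map f) := fun z => by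
  rw [← Tan.map_comp, show g.comp f = SMap.id X from SMap.ext h, Tan.map_id]

variable {V : Type u} [AddCommGroup V] [Module ℝ V] [DiffeologicalSpace V]
  {W : Type v} [AddCommGroup W] [Module ℝ W] [DiffeologicalSpace W]

/-- The fibrewise coordinates `T_k V → V × Vᵏ`. -/
def IsConvenient.powCoord (hV : IsConvenient V) (k : ℕ) : SMap (TanPow V k) (V × (Fin k → V)) where
  toFun z := (z.1.1, fun i => (hV.tanCoord (z.1.2 i)).2)
  smooth n _ hp := ⟨hp.1, fun i => (hV.tanCoord.smooth n _ (hp.2 i)).2⟩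

/-- Together with surjectivity of `affTan` this makes `affTan` bijective and gives `θ_k` a left
inverse. -/
theorem IsConvenient.powCoord_theta_affTan (hV : IsConvenient V) (k : ℕ)
    (z : V × (Fin k → V)) : hV.powCoord k (theta V k (hV.affTan k z)) = z := by
  refine Prod.ext ?_ (funext fun i => hV.velocity_affine z.1 z.2 i)
  refine (hV.plot_pt (weaklySmooth_affine z.1 z.2) 0).trans ?_
  simp

/-- The inverse `V × V → TV` of `tanCoord`, sending `(x, w)` to the velocity of the line
`s ↦ x + s w`. -/
def IsConvenient.tanLine (hV : IsConvenient V) : SMap (V × V) (Tan V) where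
  toFun z := (theta V 1 (hV.affTan 1 (z.1, fun _ => z.2))).1.2 0
  smooth n a ha := ((theta V 1).smooth n _ (hV.dSmooth_affTan 1 n
    (fun t => ((a t).1, fun _ => (a t).2)) ⟨ha.1, fun _ => ha.2⟩)).2 0

theorem IsConvenient.tanCoord_tanLine (hV : IsConvenient V) :
    Function.LeftInverse hV.tanCoord hV.tanLine := fun z => by
  have h1 := hV.powCoord_theta_affTan 1 (z.1, fun _ => z.2)
  refine Prod.ext ?_ (congrFun (congrArg Prod.snd h1) 0)
  rw [hV.tanCoord_fst]
  exact ((theta V 1 (hV.affTan 1 (z.1, fun _ => z.2))).2 0).trans (congrArg Prod.fst h1)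

/-- A tangent vector is a frame of length one, so surjectivity of `affTan 1` applies. -/
theorem IsConvenient.tanLine_surjective (hV : IsConvenient V) :
    Function.Surjective hV.tanLine := fun z => by
  induction z using Kan.ind with
  | h U p x =>
    obtain ⟨y, hy⟩ := hV.affTan_surjective 1
      (Kan.mk (F := tanHatPow 1) p ⟨(tanBase x, fun _ => x), fun _ => rfl⟩)
    refine ⟨(y.1, y.2 0), ?_⟩
    have h1 : (fun _ => y.2 0) = y.2 := funext fun i => by rw [Subsingleton.elim i 0]
    change (theta V 1 (hV.affTan 1 (y.1, fun _ => y.2 0))).1.2 0 = _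
    rw [h1, hy]
    rfl

theorem IsConvenient.tanLine_tanCoord (hV : IsConvenient V) :
    Function.LeftInverse hV.tanLine hV.tanCoord := fun z => by
  obtain ⟨y, rfl⟩ := hV.tanLine_surjective z
  rw [hV.tanCoord_tanLine]

theorem IsConvenient.tanCoord_injective (hV : IsConvenient V) :
    Function.Injective hV.tanCoord := hV.tanLine_tanCoord.injective

/-- The fibre condition forces the footprints of all entries to equal the base point, so only their
vector parts need to be recorded. -/
theorem IsConvenient.powCoord_injective (hV : IsConvenient V) (k : ℕ) :
    Function.Injective (hV.powCoord k) := fun z z' h => by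
  have h1 := congrArg Prod.fst h
  refine Subtype.ext (Prod.ext h1 (funext fun i => hV.tanCoord_injective (Prod.ext ?_ ?_)))
  · rw [hV.tanCoord_fst, hV.tanCoord_fst, z.2 i, z'.2 i]
    exact h1
  · exact congrFun (congrArg Prod.snd h) i

/-- The inverse `V × Vᵏ → T_k V` of `powCoord`. -/
def IsConvenient.powLine (hV : IsConvenient V) (k : ℕ) : SMap (V × (Fin k → V)) (TanPow V k) :=
  (theta V k).comp ⟨hV.affTan k, hV.dSmooth_affTan k⟩

theorem IsConvenient.powCoord_powLine (hV : IsConvenient V) (k : ℕ) :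
    Function.LeftInverse (hV.powCoord k) (hV.powLine k) := hV.powCoord_theta_affTan k

theorem IsConvenient.powLine_powCoord (hV : IsConvenient V) (k : ℕ) :
    Function.LeftInverse (hV.powLine k) (hV.powCoord k) := fun _ =>
  hV.powCoord_injective k (hV.powCoord_powLine k _)

theorem IsConvenient.isDiffeomorphism_theta (hV : IsConvenient V) (k : ℕ) :
    IsDiffeomorphism (theta V k) := by
  refine ⟨(theta V k).smooth, fun z => hV.affTan k (hV.powCoord k z),
    (hV.dSmooth_affTan k).comp (hV.powCoord k).smooth, fun z => ?_, hV.powLine_powCoord k⟩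
  obtain ⟨y, rfl⟩ := hV.affTan_surjective k z
  exact congrArg (hV.affTan k) (hV.powCoord_theta_affTan k y)

/-- Functionals on `W` pull back along `f` to functionals on `V`, so both sides agree after applying
any functional. -/
theorem IsConvenient.map_velocity (hV : IsConvenient V) (hW : IsConvenient W) {f : V →ₗ[ℝ] W}
    (hf : DSmooth f) {U : Cart} (p : SMap U V) (x : tanObj U) :
    f (hV.velocity p x) = hW.velocity (SMap.comp ⟨f, hf⟩ p) x := by
  refine hW.ext fun l hl => ?_
  have h1 : l.comp f ∈ smoothDual V := comp_mem_smoothDual hl hf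
  rw [hW.dual_velocity _ _ hl]
  refine (hV.dual_velocity p x h1).trans (dualDeriv_eq (fun y => ?_)
    ((Cart.contDiffAt_extendZero p h1 _).differentiableAt (by simp)).hasFDerivAt).symm
  rw [Cart.extendZero_apply]
  rfl

theorem IsConvenient.tanCoord_map (hV : IsConvenient V) (hW : IsConvenient W) {f : V →ₗ[ℝ] W}
    (hf : DSmooth f) (z : Tan V) :
    hW.tanCoord (Tan.map ⟨f, hf⟩ z) = (f (hV.tanCoord z).1, f (hV.tanCoord z).2) := by
  induction z using Kan.ind with
  | h U p x => exact Prod.ext rfl (hV.map_velocity hW hf p x).symm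

/-- Through `powCoord`, the space `T(T_k V)` becomes `T(V × Vᵏ)`, with coordinates in the convenient
space `V × Vᵏ`. The smooth linear projections to `V` separate these coordinates, and their tangent
maps are determined by `ν_k`. -/
theorem IsConvenient.nu_injective (hV : IsConvenient V) (k : ℕ) :
    Function.Injective (nu V k) := by
  intro z z' h
  have hbase : Tan.map (FiberPow.base (footprint V) k) z =
      Tan.map (FiberPow.base (footprint V) k) z' := congrArg (fun y => y.1.1) h
  have hproj : ∀ i, Tan.map (FiberPow.proj (footprint V) k i) z =
      Tan.map (FiberPow.proj (footprint V) k i) z' := fun i => congrArg (fun y => y.1.2 i) h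
  have hpi : IsConvenient (Fin k → V) := hV.pi
  apply (Tan.map_leftInverse (hV.powLine_powCoord k)).injective
  apply (hV.prod hpi).tanCoord_injective
  have hf : DSmooth (LinearMap.fst ℝ V (Fin k → V)) := dSmooth_fst
  have hs : ∀ i, DSmooth ((LinearMap.proj (R := ℝ) (φ := fun _ : Fin k => V) i).comp
      (LinearMap.snd ℝ V (Fin k → V))) := fun i => (dSmooth_eval i).comp dSmooth_snd
  have h1 : Tan.map ⟨_, hf⟩ (Tan.map (hV.powCoord k) z) =
      Tan.map ⟨_, hf⟩ (Tan.map (hV.powCoord k) z') := by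
    rw [← Tan.map_comp, ← Tan.map_comp]
    exact hbase
  have h2 : ∀ i, Tan.map ⟨_, hs i⟩ (Tan.map (hV.powCoord k) z) =
      Tan.map ⟨_, hs i⟩ (Tan.map (hV.powCoord k) z') := fun i => by
    rw [← Tan.map_comp, ← Tan.map_comp]
    -- The `i`-th vector coordinate of `powCoord` is the vector part of `tanCoord` applied to the
    -- `i`-th projection.
    have h3 := congrArg (Tan.map (SMap.comp ⟨Prod.snd, dSmooth_snd⟩ hV.tanCoord)) (hproj i)
    rw [← Tan.map_comp, ← Tan.map_comp] at h3
    exact h3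
  have h1' := congrArg hV.tanCoord h1
  have h2' := fun i => congrArg hV.tanCoord (h2 i)
  simp only [(hV.prod hpi).tanCoord_map hV] at h1' h2'
  exact Prod.ext
    (Prod.ext (Prod.mk.inj h1').1 (funext fun i => (Prod.mk.inj (h2' i)).1))
    (Prod.ext (Prod.mk.inj h1').2 (funext fun i => (Prod.mk.inj (h2' i)).2))

end TangentBundle

/-! ## The second tangent bundle of a convenient space -/

section SecondTangentBundle

variable {V : Type u} [AddCommGroup V] [Module ℝ V] [DiffeologicalSpace V]

/-- The point `(u, v₀, v₁, v₀₁)` of `T̂²U`. -/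
def tanSqMk {U : Cart} (u : U) (v₀ v₁ v₀₁ : EuclideanSpace ℝ (Fin U.dim)) : tanObj (tanObj U) :=
  tanMk (tanMk u v₀) ((split U).symm (v₁, v₀₁))

theorem exists_tanSqMk {U : Cart} (ξ : tanObj (tanObj U)) :
    ∃ u v₀ v₁ v₀₁, tanSqMk u v₀ v₁ v₀₁ = ξ := by
  refine ⟨tanBase (tanBase ξ), tanVec (tanBase ξ), (split U (tanVec ξ)).1,
    (split U (tanVec ξ)).2, ?_⟩
  rw [tanSqMk, tanMk_base_vec, Prod.mk.eta, ContinuousLinearEquiv.symm_apply_apply, tanMk_base_vec]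

theorem flipHat_tanSqMk {U : Cart} (u : U) (v₀ v₁ v₀₁ : EuclideanSpace ℝ (Fin U.dim)) :
    flipHat.app U (tanSqMk u v₀ v₁ v₀₁) = tanSqMk u v₁ v₀ v₀₁ := by
  change tanMk (tanMk (tanBase (tanBase (tanSqMk u v₀ v₁ v₀₁))) _) _ = _
  simp only [tanSqMk, tanBase_mk, tanVec_mk, ContinuousLinearEquiv.apply_symm_apply]

/-- The projection `T̂U → U` as a morphism. -/
def tanProj (U : Cart) : SMap (tanObj U) U := ⟨tanBase, dSmooth_tanBase U⟩

theorem tanMap_tanProj {U : Cart} (u : U) (v₀ v₁ v₀₁ : EuclideanSpace ℝ (Fin U.dim)) :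
    tanMap (tanProj U) (tanSqMk u v₀ v₁ v₀₁) = tanMk u v₁ := by
  have h1 : HasFDerivAt (Cart.extend fun y => (tanProj U y).1)
      ((ContinuousLinearMap.fst ℝ _ _).comp (split U).toContinuousLinearMap)
      (tanMk u v₀ : tanObj U).1 := by
    refine (hasFDerivAt_fst.comp _ (split U).hasFDerivAt).congr_of_eventuallyEq ?_
    filter_upwards [(tanObj U).isOpen.mem_nhds (tanMk u v₀).2] with y hy
    exact Cart.extend_apply (U := tanObj U) (fun y => (tanProj U y).1) ⟨y, hy⟩
  rw [tanMap_apply, tanSqMk, tanBase_mk, tanVec_mk, (Cart.hasFDerivAt _ _).unique h1]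
  refine congrArg₂ tanMk (tanBase_mk u v₀) ?_
  simp

/-- The map `T̂U → V` of weak derivatives of a plot. -/
def IsConvenient.velocityMap (hV : IsConvenient V) {U : Cart} (p : SMap U V) : SMap (tanObj U) V :=
  ⟨hV.velocity p, hV.dSmooth_velocity p⟩

/-- The product rule for `(y, v) ↦ D_y(l ∘ p)(v)`. This formula carries both the flip, by its
symmetry in `v₀` and `v₁`, and the vertical lift, by the vanishing of its first term. -/
theorem IsConvenient.dualDeriv_velocityMap (hV : IsConvenient V) {U : Cart} (p : SMap U V)
    {l : V →ₗ[ℝ] ℝ} (hl : l ∈ smoothDual V) (u : U)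
    (v₀ v₁ v₀₁ : EuclideanSpace ℝ (Fin U.dim)) :
    dualDeriv (hV.velocityMap p) l (tanSqMk u v₀ v₁ v₀₁) =
      fderiv ℝ (fderiv ℝ fun y => l (Cart.extendZero p y)) u.1 v₁ v₀ +
        fderiv ℝ (fun y => l (Cart.extendZero p y)) u.1 v₀₁ := by
  set F := fun y => l (Cart.extendZero p y)
  have h1 : HasFDerivAt (fderiv ℝ F) (fderiv ℝ (fderiv ℝ F) u.1)
      (split U (tanMk u v₀ : tanObj U).1).1 := by
    have h2 := ((Cart.contDiffOn_extendZero p hl).fderiv_of_isOpen (m := ∞) U.isOpen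
      (by simp)).contDiffAt (U.isOpen.mem_nhds u.2)
    simpa [tanMk] using (h2.differentiableAt (by simp)).hasFDerivAt
  have hfst : HasFDerivAt (fun z => (split U z).1)
      ((ContinuousLinearMap.fst ℝ _ _).comp (split U).toContinuousLinearMap)
      (tanMk u v₀ : tanObj U).1 := hasFDerivAt_fst.comp _ (split U).hasFDerivAt
  have hsnd : HasFDerivAt (fun z => (split U z).2)
      ((ContinuousLinearMap.snd ℝ _ _).comp (split U).toContinuousLinearMap)
      (tanMk u v₀ : tanObj U).1 := hasFDerivAt_snd.comp _ (split U).hasFDerivAt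
  have h3 := (h1.comp (f := fun z => (split U z).1) (tanMk u v₀ : tanObj U).1 hfst).clm_apply hsnd
  have hb : tanBase (tanSqMk u v₀ v₁ v₀₁) = tanMk u v₀ := tanBase_mk _ _
  have hv : tanVec (tanSqMk u v₀ v₁ v₀₁) = (split U).symm (v₁, v₀₁) := tanVec_mk _ _
  rw [← hb] at h3
  rw [dualDeriv_eq (p := hV.velocityMap p) (fun y => hV.dual_velocity p y hl) h3, hv, hb]
  have e1 : split U (tanMk u v₀ : tanObj U).1 = (u.1, v₀) := (split U).apply_symm_apply _
  simp [e1, add_comm]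

/-- The coordinates `T²V → V⁴`. -/
def IsConvenient.tanSqCoord (hV : IsConvenient V) : SMap (Tan (Tan V)) ((V × V) × (V × V)) :=
  (hV.prod hV).tanCoord.comp (Tan.map hV.tanCoord)

/-- The inverse `V⁴ → T²V` of `tanSqCoord`. -/
def IsConvenient.tanSqLine (hV : IsConvenient V) : SMap ((V × V) × (V × V)) (Tan (Tan V)) :=
  (Tan.map hV.tanLine).comp (hV.prod hV).tanLine

theorem IsConvenient.tanSqLine_tanSqCoord (hV : IsConvenient V) :
    Function.LeftInverse hV.tanSqLine hV.tanSqCoord := fun z =>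
  (congrArg (Tan.map hV.tanLine) ((hV.prod hV).tanLine_tanCoord _)).trans
    (Tan.map_leftInverse hV.tanLine_tanCoord z)

theorem IsConvenient.tanSqCoord_tanSqLine (hV : IsConvenient V) :
    Function.LeftInverse hV.tanSqCoord hV.tanSqLine := fun z =>
  (congrArg (hV.prod hV).tanCoord (Tan.map_leftInverse hV.tanCoord_tanLine _)).trans
    ((hV.prod hV).tanCoord_tanLine z)

/-- In `V⁴` the class of a second-order tangent vector is its value, two first derivatives and one
second derivative of `p`. Linearity of the projections `V × V → V` lets the outer derivative be
taken componentwise. -/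
theorem IsConvenient.tanSqCoord_thetaSq (hV : IsConvenient V) {U : Cart} (p : SMap U V) (u : U)
    (v₀ v₁ v₀₁ : EuclideanSpace ℝ (Fin U.dim)) :
    hV.tanSqCoord (thetaSq V (Kan.mk (F := tanHatSq.toDflg) p (tanSqMk u v₀ v₁ v₀₁))) =
      ((p u, hV.velocity p (tanMk u v₀)),
        (hV.velocity p (tanMk u v₁), hV.velocity (hV.velocityMap p) (tanSqMk u v₀ v₁ v₀₁))) := by
  have hf : DSmooth (LinearMap.fst ℝ V V) := dSmooth_fst
  have hs : DSmooth (LinearMap.snd ℝ V V) := dSmooth_snd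
  have h0 : hV.tanCoord (Kan.mk (F := tanHat.toDflg) p (tanBase (tanSqMk u v₀ v₁ v₀₁))) =
      (p u, hV.velocity p (tanMk u v₀)) :=
    (congrArg (fun y : tanObj U => (p (tanBase y), hV.velocity p y)) (tanBase_mk _ _)).trans
      (Prod.ext (congrArg p (tanBase_mk u v₀)) rfl)
  refine Prod.ext h0 (Prod.ext ?_ ?_)
  -- The first component of `tanCoord ∘ Tp` is `p ∘ tanProj U`, whose derivative sees only the
  -- horizontal direction `v₁`.
  · refine ((hV.prod hV).map_velocity hV hf _ _).trans ?_
    rw [← tanMap_tanProj u v₀ v₁ v₀₁, ← hV.velocity_comp]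
    rfl
  · exact (hV.prod hV).map_velocity hV hs _ _

/-- The flip of `V⁴`. -/
def flipCoord (V : Type u) [DiffeologicalSpace V] :
    SMap ((V × V) × (V × V)) ((V × V) × (V × V)) where
  toFun z := ((z.1.1, z.2.1), (z.1.2, z.2.2))
  smooth _ _ hp := ⟨⟨hp.1.1, hp.2.1⟩, ⟨hp.1.2, hp.2.2⟩⟩

theorem IsConvenient.velocity_velocityMap_symm (hV : IsConvenient V) {U : Cart} (p : SMap U V)
    (u : U) (v₀ v₁ v₀₁ : EuclideanSpace ℝ (Fin U.dim)) :
    hV.velocity (hV.velocityMap p) (tanSqMk u v₀ v₁ v₀₁) =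
      hV.velocity (hV.velocityMap p) (tanSqMk u v₁ v₀ v₀₁) := by
  refine hV.ext fun l hl => ?_
  rw [hV.dual_velocity _ _ hl, hV.dual_velocity _ _ hl, hV.dualDeriv_velocityMap p hl,
    hV.dualDeriv_velocityMap p hl]
  congr 1
  exact ((Cart.contDiffAt_extendZero p hl u).isSymmSndFDerivAt
    (by rw [minSmoothness_of_isRCLikeNormedField]
        exact WithTop.coe_le_coe.2 (le_top : (2 : ℕ∞) ≤ ⊤))) _ _

/-- The swap of the middle entries of `V⁴` is smooth on all of `T²V`; only on classes coming from
`θ²` must it be compared with `τ̂`. -/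
theorem IsConvenient.exists_flip (hV : IsConvenient V) :
    ∃ τ : SMap (Tan (Tan V)) (Tan (Tan V)), ∀ z : Kan tanHatSq.toDflg V,
      τ (thetaSq V z) = thetaSq V (Kan.trans flipHat V z) := by
  refine ⟨hV.tanSqLine.comp ((flipCoord V).comp hV.tanSqCoord), fun z => ?_⟩
  induction z using Kan.ind with
  | h U p ξ =>
    obtain ⟨u, v₀, v₁, v₀₁, rfl⟩ := exists_tanSqMk ξ
    apply hV.tanSqLine_tanSqCoord.injective
    have h1 : Kan.trans flipHat V (Kan.mk (F := tanHatSq.toDflg) p (tanSqMk u v₀ v₁ v₀₁)) =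
        Kan.mk (F := tanHatSq.toDflg) p (tanSqMk u v₁ v₀ v₀₁) :=
      congrArg (Kan.mk (F := tanHatSq.toDflg) p) (flipHat_tanSqMk u v₀ v₁ v₀₁)
    rw [h1, hV.tanSqCoord_thetaSq]
    refine (hV.tanSqCoord_tanSqLine _).trans ((congrArg (flipCoord V)
      (hV.tanSqCoord_thetaSq p u v₀ v₁ v₀₁)).trans ?_)
    exact Prod.ext rfl (Prod.ext rfl (hV.velocity_velocityMap_symm p u v₀ v₁ v₀₁))

theorem IsConvenient.tanSqCoord_vlift (hV : IsConvenient V) (z : Tan V) :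
    hV.tanSqCoord (vlift V z) = (((hV.tanCoord z).1, 0), (0, (hV.tanCoord z).2)) := by
  induction z using Kan.ind with
  | h U p x =>
    change tanObj U at x
    refine (hV.tanSqCoord_thetaSq p (tanBase x) 0 0 (tanVec x)).trans ?_
    have h0 : hV.velocity p (tanMk (tanBase x) 0) = 0 := hV.ext fun l hl => by
      rw [hV.dual_velocity _ _ hl, dualDeriv, tanVec_mk, map_zero, map_zero]
    have h1 : hV.velocity (hV.velocityMap p) (tanSqMk (tanBase x) 0 0 (tanVec x)) =
        hV.velocity p x := hV.ext fun l hl => by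
      rw [hV.dual_velocity _ _ hl, hV.dual_velocity _ _ hl, hV.dualDeriv_velocityMap p hl,
        map_zero, zero_add, dualDeriv]
    rw [h0, h1]
    rfl

theorem IsConvenient.isInduction_vlift (hV : IsConvenient V) : IsInduction (vlift V) := by
  -- The outer entries of `V⁴` give a smooth retraction of the vertical lift, so it is injective and
  -- reflects plots.
  have h1 : ∀ z, hV.tanLine ((hV.tanSqCoord (vlift V z)).1.1, (hV.tanSqCoord (vlift V z)).2.2) = z :=
    fun z => by
      rw [hV.tanSqCoord_vlift]
      exact hV.tanLine_tanCoord z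
  refine ⟨fun z z' h => ?_, fun n p => ⟨(vlift V).smooth n p, fun hp => ?_⟩⟩
  · rw [← h1 z, ← h1 z', h]
  · have h2 := hV.tanSqCoord.smooth n _ hp
    have h3 := hV.tanLine.smooth n
      (fun t => ((hV.tanSqCoord (vlift V (p t))).1.1, (hV.tanSqCoord (vlift V (p t))).2.2))
      ⟨h2.1.1, h2.2.2⟩
    exact (congrArg IsPlot (funext fun t => h1 (p t))).mp h3

end SecondTangentBundle

/-! ## Elasticity -/

theorem IsConvenient.preElastic {V : Type u} [AddCommGroup V] [Module ℝ V] [DiffeologicalSpace V]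
    (hV : IsConvenient V) : PreElastic V where
  e1 k _ := hV.isDiffeomorphism_theta k
  e2 := hV.exists_flip
  e3 := hV.isInduction_vlift
  e4 k _ := hV.nu_injective k

/-- Diffeological spaces that underlie a convenient vector space. -/
def AdmitsConvenientStructure (X : Type u) [DiffeologicalSpace X] : Prop :=
  ∃ (_ : AddCommGroup X) (_ : Module ℝ X), IsConvenient X

/-- Elasticity refers only to the diffeology, so the linear structure may be transported from `X ×
Xᵏ` along the diffeomorphism `powCoord`; products supply convenience. -/
theorem AdmitsConvenientStructure.tanPow {X : Type u} [DiffeologicalSpace X]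
    (hX : AdmitsConvenientStructure X) (k : ℕ) : AdmitsConvenientStructure (TanPow X k) := by
  obtain ⟨_, _, hX⟩ := hX
  let e : TanPow X k ≃ X × (Fin k → X) :=
    ⟨hX.powCoord k, hX.powLine k, hX.powLine_powCoord k, hX.powCoord_powLine k⟩
  let _ : AddCommGroup (TanPow X k) := e.addCommGroup
  let _ : Module ℝ (TanPow X k) := e.module ℝ
  refine ⟨inferInstance, inferInstance,
    IsConvenient.of_linearEquiv (hX.prod hX.pi) (e.linearEquiv ℝ) fun n p =>
      ⟨(hX.powCoord k).smooth n p, fun hp => ?_⟩⟩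
  exact (congrArg IsPlot (funext fun t => hX.powLine_powCoord k (p t))).mp
    ((hX.powLine k).smooth n _ hp)

theorem AdmitsConvenientStructure.isElastic {X : Type u} [d : DiffeologicalSpace X]
    (hX : AdmitsConvenientStructure X) : IsElastic X := by
  have h1 : ∀ ks : List ℕ,
      AdmitsConvenientStructure (ks.foldr Dflg.tanPow (Dflg.mk X d)).carrier := fun ks => by
    induction ks with
    | nil => exact hX
    | cons k ks ih => exact ih.tanPow k
  have h2 : ∀ {Y : Type u} [DiffeologicalSpace Y], AdmitsConvenientStructure Y → PreElastic Y := by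
    rintro Y _ ⟨_, _, hY⟩
    exact hY.preElastic
  exact ⟨h2 hX, fun ks => h2 (h1 ks)⟩

end ElasticDflg

end

theorem mainTheorem7 {V : Type*} [AddCommGroup V] [Module ℝ V] [DiffeologicalSpace V]
    [ElasticDflg.DiffeologicalVectorSpace V] (hV : ElasticDflg.IsConvenient V) :
    ElasticDflg.IsElastic V :=
  ElasticDflg.AdmitsConvenientStructure.isElastic ⟨inferInstance, inferInstance, hV⟩
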